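/- For each $n\in\mathbb Z$ let $\mathbb A^2_n=\mathrm{Spec}\,\mathbb Z[x_n,y_n]$, and let $\mathbb W$ be obtained by glueing $\mathbb A^2_n\setminus\{x_n=0\}$ to $\mathbb A^2_{n+1}\setminus\{y_{n+1}=0\}$ along $y_{n+1}=x_n^{-1}$, $x_{n+1}y_{n+1}=x_ny_n$, for all $n$. Let $\pi:\mathbb W\to\mathbb A^1$ be the map given by $x_ny_n$ on every chart, $\mathbb W_0=\pi^{-1}(0)$, and $x=x_0$, so that $x_n=\pi^nx$ and $y_n=\pi^{1-n}x^{-1}$ on $\mathbb W\setminus\mathbb W_0$. Let $w_n=\{x_n=y_n=0\}\subset\mathbb A^2_n$, let $\mathbb P^1_n$ be the closure in $\mathbb W$ of $\{y_n=0\}\subset\mathbb A^2_n$ (it contains $w_n$ and $w_{n+1}$), and let $(\mathbb G_m)_n=\mathbb P^1_n\setminus(w_n\cup w_{n+1})$. Let $\mathcal L$ be the line bundle on $\mathbb W$ glued from trivial bundles $\mathcal O e_n$ on $\mathbb A^2_n$ with transition function $x_n$ on $\mathbb A^2_n\cap\mathbb A^2_{n+1}$: a function $f$ on $\mathbb A^2_n$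 is identified with $x_n^{-1}f$ on $\mathbb A^2_{n+1}$. The open subset $\mathbb W\setminus\mathbb W_0$ is $\mathrm{Spec}\,\mathbb Z[x^{\pm1},\pi^{\pm1}]$; restricting global sections of $\mathcal L$ to it and expressing them in a frame of $\mathcal L$ there gives a homomorphism $H^0(\mathbb W,\mathcal L)\to\mathbb Z[x^{\pm1},\pi^{\pm1}]$. (1) For the frame $\pi^{-1}e_1$ this homomorphism is injective. Its image is the $\mathbb Z$-span of the monomials $\pi^kx^m$ ($k,m\in\mathbb Z$) with $k\ge\frac{m^2+m}{2}+1$. The nonvanishing locus of the section corresponding to such a monomial is $$(\mathbb W\setminus\mathbb W_0)\cup(\mathbb G_m)_m\cup(\mathbb G_m)_{m+1}\cup w_{m+1}$$ if the inequality is an equality, and $\mathbb W\setminus\mathbb W_0$ if the inequality is strict. (2) More generally, for every $n\in\mathbb Z$ and the given frame $e_n$ of $\mathcal L$ on $\mathbb A^2_n$, this homomorphism is injective. Its image is the $\mathbb Z$-span of the monomials $\pi^kx^m$ with $k\ge\frac{m^2+(2n-1)m}{2}$. The nonvanishing locus of the section corresponding to such a monomial is $$(\mathbb W\setminus\mathbb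 W_0)\cup(\mathbb G_m)_{m+n-1}\cup(\mathbb G_m)_{m+n}\cup w_{m+n}$$ if the inequality is an equality, and $\mathbb W\setminus\mathbb W_0$ if the inequality is strict. -/

import Mathlib

open CategoryTheory AlgebraicGeometry Limits MvPolynomial Opposite

noncomputable section

namespace TateCover

/-- The coordinate ring `ℤ[xₙ, yₙ]` of the affine plane; `X 0` is `xₙ` and `X 1` is `yₙ`. -/
abbrev PlaneRing : Type := MvPolynomial (Fin 2) ℤ
/-- The coordinate ring `ℤ[xₙ, yₙ, xₙ⁻¹]` of the overlap of the charts `n` and `n + 1`, in the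
coordinates of the chart `n`. -/
abbrev OverlapRing : Type := Localization.Away (X 0 : PlaneRing)
/-- The Laurent polynomial ring `ℤ[x^±1, π^±1]`; the exponent `(k, m)` stands for `π ^ k * x ^ m`. -/
abbrev LaurentRing : Type := AddMonoidAlgebra ℤ (ℤ × ℤ)

/-- The monomial `π ^ k * x ^ m`. -/
def laurentMonomial (k m : ℤ) : LaurentRing := AddMonoidAlgebra.single (k, m) 1

theorem laurentMonomial_mul (k m k' m' : ℤ) :
    laurentMonomial k m * laurentMonomial k' m' = laurentMonomial (k + k') (m + m') := by
  simp [laurentMonomial, AddMonoidAlgebra.single_mul_single]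

theorem laurentMonomial_zero : laurentMonomial 0 0 = 1 := rfl

theorem isUnit_laurentMonomial (k m : ℤ) : IsUnit (laurentMonomial k m) :=
  IsUnit.of_mul_eq_one (laurentMonomial (-k) (-m)) (by
    rw [laurentMonomial_mul]; simp [laurentMonomial_zero])

/-- Restriction of functions from the chart `n` to its overlap with the chart `n + 1`. -/
def leftToOverlap : PlaneRing →+* OverlapRing := algebraMap _ _

def overlapX : OverlapRing := algebraMap PlaneRing OverlapRing (X 0)
def overlapY : OverlapRing := algebraMap PlaneRing OverlapRing (X 1)
def overlapXInv : OverlapRing := IsLocalization.Away.invSelf (X 0 : PlaneRing)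

theorem overlapX_mul_inv : overlapX * overlapXInv = 1 :=
  IsLocalization.Away.mul_invSelf (X 0 : PlaneRing)

/-- Restriction of functions from the chart `n + 1` to its overlap with the chart `n`: as
`yₙ₊₁ = xₙ⁻¹` and `xₙ₊₁ yₙ₊₁ = xₙ yₙ`, one has `xₙ₊₁ ↦ xₙ² yₙ` and `yₙ₊₁ ↦ xₙ⁻¹`. -/
def rightToOverlap : PlaneRing →+* OverlapRing :=
  (aeval ![overlapX ^ 2 * overlapY, overlapXInv] : PlaneRing →ₐ[ℤ] OverlapRing).toRingHom

/-- Restriction of functions from the chart `n` to the torus, `xₙ ↦ π ^ n * x` and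
`yₙ ↦ π ^ (1 - n) * x⁻¹`. -/
def chartToTorus (n : ℤ) : PlaneRing →+* LaurentRing :=
  (aeval ![laurentMonomial n 1, laurentMonomial (1 - n) (-1)] :
    PlaneRing →ₐ[ℤ] LaurentRing).toRingHom

@[simp] theorem chartToTorus_X0 (n : ℤ) : chartToTorus n (X 0) = laurentMonomial n 1 := by
  simp [chartToTorus]
@[simp] theorem chartToTorus_X1 (n : ℤ) :
    chartToTorus n (X 1) = laurentMonomial (1 - n) (-1) := by
  simp [chartToTorus]
@[simp] theorem rightToOverlap_X0 : rightToOverlap (X 0) = overlapX ^ 2 * overlapY := by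
  simp [rightToOverlap]
@[simp] theorem rightToOverlap_X1 : rightToOverlap (X 1) = overlapXInv := by
  simp [rightToOverlap]

/-- Restriction of functions from the overlap of the charts `n` and `n + 1` to the torus. -/
def overlapToTorus (n : ℤ) : OverlapRing →+* LaurentRing :=
  IsLocalization.Away.lift (X 0 : PlaneRing) (g := chartToTorus n)
    (by simpa using isUnit_laurentMonomial n 1)

theorem overlapToTorus_comp_left (n : ℤ) :
    (overlapToTorus n).comp leftToOverlap = chartToTorus n :=
  IsLocalization.Away.lift_comp _ _

@[simp] theorem overlapToTorus_X (n : ℤ) : overlapToTorus n overlapX = laurentMonomial n 1 := by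
  simp [overlapToTorus, overlapX, IsLocalization.Away.lift_eq]
@[simp] theorem overlapToTorus_Y (n : ℤ) :
    overlapToTorus n overlapY = laurentMonomial (1 - n) (-1) := by
  simp [overlapToTorus, overlapY, IsLocalization.Away.lift_eq]
@[simp] theorem overlapToTorus_XInv (n : ℤ) :
    overlapToTorus n overlapXInv = laurentMonomial (-n) (-1) := by
  have h := congrArg (overlapToTorus n) overlapX_mul_inv
  rw [map_mul, overlapToTorus_X, map_one] at h
  refine (isUnit_laurentMonomial n 1).mul_left_cancel ?_
  rw [h, laurentMonomial_mul]; simp [laurentMonomial_zero]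

theorem overlapToTorus_comp_right (n : ℤ) :
    (overlapToTorus n).comp rightToOverlap = chartToTorus (n + 1) := by
  refine MvPolynomial.ringHom_ext (fun r => by simp) (fun i => ?_)
  fin_cases i
  · simp [pow_two, laurentMonomial_mul]
  · simp

/-- The involution `xₙ ↦ xₙ⁻¹`, `yₙ ↦ xₙ² yₙ` (used to see that `rightToOverlap` is a localization). -/
def overlapSwap : OverlapRing →+* OverlapRing :=
  IsLocalization.Away.lift (X 0 : PlaneRing)
    (g := (aeval ![overlapXInv, overlapX ^ 2 * overlapY] :
      PlaneRing →ₐ[ℤ] OverlapRing).toRingHom)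
    (by simpa using IsUnit.of_mul_eq_one_right _ overlapX_mul_inv)

theorem overlapSwap_X : overlapSwap overlapX = overlapXInv := by
  simp [overlapSwap, overlapX, IsLocalization.Away.lift_eq]
theorem overlapSwap_Y : overlapSwap overlapY = overlapX ^ 2 * overlapY := by
  simp [overlapSwap, overlapY, IsLocalization.Away.lift_eq]
theorem overlapSwap_XInv : overlapSwap overlapXInv = overlapX := by
  have h := congrArg overlapSwap overlapX_mul_inv
  rw [map_mul, overlapSwap_X, map_one] at h
  calc _ = (overlapX * overlapXInv) * overlapSwap overlapXInv := by rw [overlapX_mul_inv, one_mul]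
    _ = _ := by rw [mul_assoc, h, mul_one]

theorem overlapSwap_comp : overlapSwap.comp overlapSwap = RingHom.id _ := by
  refine IsLocalization.ringHom_ext (Submonoid.powers (X 0 : PlaneRing)) ?_
  refine MvPolynomial.ringHom_ext (fun r => by simp) (fun i => ?_)
  fin_cases i
  · change overlapSwap (overlapSwap overlapX) = overlapX
    rw [overlapSwap_X, overlapSwap_XInv]
  · change overlapSwap (overlapSwap overlapY) = overlapY
    rw [overlapSwap_Y, map_mul, map_pow, overlapSwap_X, overlapSwap_Y, ← mul_assoc, ← mul_pow,
      mul_comm overlapXInv, overlapX_mul_inv, one_pow, one_mul]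

/-- The involution exchanging the two coordinates of the plane. -/
def planeSwap : PlaneRing →+* PlaneRing := (rename (Equiv.swap 0 1) : PlaneRing →ₐ[ℤ] PlaneRing).toRingHom

theorem planeSwap_comp : planeSwap.comp planeSwap = RingHom.id _ := by
  refine MvPolynomial.ringHom_ext (fun r => by simp [planeSwap]) (fun i => ?_)
  fin_cases i <;> simp [planeSwap]

theorem rightToOverlap_eq :
    rightToOverlap = overlapSwap.comp (leftToOverlap.comp planeSwap) := by
  refine MvPolynomial.ringHom_ext (fun r => by simp [planeSwap]) (fun i => ?_)
  fin_cases i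
  · rw [show (⟨0, by omega⟩ : Fin 2) = 0 from rfl, rightToOverlap_X0, ← overlapSwap_Y]
    simp [planeSwap, leftToOverlap, overlapY]
  · rw [show (⟨1, by omega⟩ : Fin 2) = 1 from rfl, rightToOverlap_X1, ← overlapSwap_X]
    simp [planeSwap, leftToOverlap, overlapX]

theorem isIso_specMap_of_invol {R : Type} [CommRing R] (f : R →+* R)
    (h : f.comp f = RingHom.id _) : IsIso (Spec.map (CommRingCat.ofHom f)) := by
  have : CommRingCat.ofHom f ≫ CommRingCat.ofHom f = 𝟙 _ := by
    rw [← CommRingCat.ofHom_comp, h]; rfl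
  have : IsIso (CommRingCat.ofHom f) := ⟨_, this, this⟩
  infer_instance

instance isOpenImmersion_left : IsOpenImmersion (Spec.map (CommRingCat.ofHom leftToOverlap)) :=
  inferInstanceAs (IsOpenImmersion (Spec.map (CommRingCat.ofHom
    (algebraMap PlaneRing (Localization.Away (X 0 : PlaneRing))))))

instance isOpenImmersion_right : IsOpenImmersion (Spec.map (CommRingCat.ofHom rightToOverlap)) := by
  have := isIso_specMap_of_invol _ overlapSwap_comp
  have := isIso_specMap_of_invol _ planeSwap_comp
  rw [rightToOverlap_eq, CommRingCat.ofHom_comp, CommRingCat.ofHom_comp, Spec.map_comp,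
    Spec.map_comp]
  infer_instance

theorem chartToTorus_monomial (n : ℤ) (a : Fin 2 →₀ ℕ) (r : ℤ) :
    chartToTorus n (monomial a r) = AddMonoidAlgebra.single
      (n * a 0 + (1 - n) * a 1, (a 0 : ℤ) - a 1) r := by
  have hp (k m : ℤ) (N : ℕ) : laurentMonomial k m ^ N = laurentMonomial (N * k) (N * m) := by
    simp [laurentMonomial, AddMonoidAlgebra.single_pow]
  simp only [chartToTorus, AlgHom.toRingHom_eq_coe, RingHom.coe_coe, aeval_monomial]
  rw [Finsupp.prod_fintype _ _ (by simp)]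
  simp only [Fin.prod_univ_two, Matrix.cons_val_zero, Matrix.cons_val_one, hp, laurentMonomial_mul]
  simp only [laurentMonomial, eq_intCast]
  rw [← zsmul_eq_mul, AddMonoidAlgebra.smul_single]
  congr 1
  · ext <;> simp <;> ring
  · simp

theorem chartToTorus_injective (n : ℤ) : Function.Injective (chartToTorus n) := by
  let e : (Fin 2 →₀ ℕ) → ℤ × ℤ := fun a => (n * a 0 + (1 - n) * a 1, (a 0 : ℤ) - a 1)
  have he : Function.Injective e := by
    intro a b h
    simp only [e, Prod.mk.injEq] at h
    obtain ⟨h1, h2⟩ := h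
    have h3 : (a 1 : ℤ) = b 1 := by linear_combination h1 - n * h2
    have h4 : (a 0 : ℤ) = b 0 := by linear_combination h2 + h3
    ext i; fin_cases i
    · exact_mod_cast h4
    · exact_mod_cast h3
  have : ∀ p : PlaneRing, chartToTorus n p =
      (AddMonoidAlgebra.mapDomain e p : LaurentRing) := by
    intro p
    induction p using MvPolynomial.induction_on' with
    | monomial a r =>
      rw [chartToTorus_monomial]
      exact (AddMonoidAlgebra.mapDomain_single (R := ℤ) (f := e)).symm
    | add p q hp hq =>
      rw [map_add, hp, hq]
      exact (AddMonoidAlgebra.mapDomain_add (R := ℤ) e _ _).symm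
  intro p q h
  rw [this, this] at h
  exact AddMonoidAlgebra.mapDomain_injective he h

theorem isLocalization_chartToTorus (n : ℤ) :
    @IsLocalization.Away PlaneRing _ (X 0 * X 1) LaurentRing _ (chartToTorus n).toAlgebra := by
  let _ := (chartToTorus n).toAlgebra
  have hal : ∀ p, algebraMap PlaneRing LaurentRing p = chartToTorus n p := fun _ => rfl
  have hpi : chartToTorus n (X 0 * X 1) = laurentMonomial 1 0 := by
    rw [map_mul, chartToTorus_X0, chartToTorus_X1, laurentMonomial_mul]; simp
  have hpow (N : ℕ) : laurentMonomial 1 0 ^ N = laurentMonomial N 0 := by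
    simp [laurentMonomial, AddMonoidAlgebra.single_pow]
  refine IsLocalization.Away.mk (R := PlaneRing) (S := LaurentRing) (X 0 * X 1) ?_ ?_ ?_
  · rw [hal, hpi]; exact isUnit_laurentMonomial 1 0
  · intro t
    simp only [hal, hpi, hpow]
    induction t using AddMonoidAlgebra.induction_linear with
    | zero => exact ⟨0, 0, by simp⟩
    | add s t hs ht =>
      obtain ⟨N, a, ha⟩ := hs
      obtain ⟨M, b, hb⟩ := ht
      refine ⟨N + M, (X 0 * X 1) ^ M * a + (X 0 * X 1) ^ N * b, ?_⟩
      have hadd : laurentMonomial ((N + M : ℕ) : ℤ) 0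
          = laurentMonomial N 0 * laurentMonomial M 0 := by
        rw [laurentMonomial_mul]; simp
      rw [map_add, map_mul, map_mul, map_pow, map_pow, hpi, hpow, hpow, ← ha, ← hb, hadd]
      ring
    | single d r =>
      obtain ⟨k, m⟩ := d
      let N : ℕ := (k - n * m).natAbs + m.natAbs
      let b : ℕ := (k - n * m + N).toNat
      let c : ℕ := (k - n * m + N + m).toNat
      refine ⟨N, monomial (Finsupp.single 0 c + Finsupp.single 1 b) r, ?_⟩
      have hb : (b : ℤ) = k - n * m + N := Int.toNat_of_nonneg (by omega)
      have hc : (c : ℤ) = k - n * m + N + m := Int.toNat_of_nonneg (by omega)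
      rw [chartToTorus_monomial, laurentMonomial, AddMonoidAlgebra.single_mul_single]
      congr 1
      · simp only [Finsupp.add_apply, Finsupp.single_apply]
        ext
        · simp [hb, hc]; ring
        · simp [hb, hc]
      · simp
  · intro a b h
    exact ⟨0, by rw [chartToTorus_injective n h]⟩

instance isOpenImmersion_torus (n : ℤ) :
    IsOpenImmersion (Spec.map (CommRingCat.ofHom (chartToTorus n))) := by
  let _ := (chartToTorus n).toAlgebra
  have := isLocalization_chartToTorus n
  exact IsOpenImmersion.of_isLocalization (R := PlaneRing) (S := LaurentRing) (X 0 * X 1)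

theorem range_torus (n : ℤ) :
    Set.range (PrimeSpectrum.comap (chartToTorus n)) =
      PrimeSpectrum.basicOpen (X 0 * X 1 : PlaneRing) := by
  let _ := (chartToTorus n).toAlgebra
  have := isLocalization_chartToTorus n
  exact PrimeSpectrum.localization_away_comap_range LaurentRing (X 0 * X 1 : PlaneRing)

theorem specMap_overlapToTorus_left (n : ℤ) :
    Spec.map (CommRingCat.ofHom (overlapToTorus n)) ≫ Spec.map (CommRingCat.ofHom leftToOverlap) =
      Spec.map (CommRingCat.ofHom (chartToTorus n)) := by
  rw [← Spec.map_comp, ← CommRingCat.ofHom_comp, overlapToTorus_comp_left]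

theorem specMap_overlapToTorus_right (n : ℤ) :
    Spec.map (CommRingCat.ofHom (overlapToTorus n)) ≫ Spec.map (CommRingCat.ofHom rightToOverlap) =
      Spec.map (CommRingCat.ofHom (chartToTorus (n + 1))) := by
  rw [← Spec.map_comp, ← CommRingCat.ofHom_comp, overlapToTorus_comp_right]

instance isOpenImmersion_overlapToTorus (n : ℤ) :
    IsOpenImmersion (Spec.map (CommRingCat.ofHom (overlapToTorus n))) := by
  have : IsOpenImmersion (Spec.map (CommRingCat.ofHom (overlapToTorus n)) ≫
      Spec.map (CommRingCat.ofHom leftToOverlap)) := by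
    rw [specMap_overlapToTorus_left]
    infer_instance
  exact IsOpenImmersion.of_comp _ (Spec.map (CommRingCat.ofHom leftToOverlap))

/-- The pieces of the gluing: the charts `𝔸²ₙ`, the overlap of the charts `n` and `n + 1`, and the
torus in which the overlaps `n - 1` and `n` meet inside the chart `n`. -/
inductive Piece : Type
  | torus : Piece
  | overlap (n : ℤ) : Piece
  | chart (n : ℤ) : Piece

namespace Piece

/-- The inclusions between the pieces. -/
inductive Hom : Piece → Piece → Type
  | id (c : Piece) : Hom c c
  | torusOverlap (n : ℤ) : Hom torus (overlap n)
  | torusChart (n : ℤ) : Hom torus (chart n)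
  | left (n m : ℤ) (h : m = n) : Hom (overlap n) (chart m)
  | right (n m : ℤ) (h : m = n + 1) : Hom (overlap n) (chart m)

def Hom.comp : {a b c : Piece} → Hom a b → Hom b c → Hom a c
  | _, _, _, .id _, g => g
  | _, _, _, .torusOverlap n, .id _ => .torusOverlap n
  | _, _, _, .torusOverlap _, .left _ m _ => .torusChart m
  | _, _, _, .torusOverlap _, .right _ m _ => .torusChart m
  | _, _, _, .torusChart n, .id _ => .torusChart n
  | _, _, _, .left n m h, .id _ => .left n m h
  | _, _, _, .right n m h, .id _ => .right n m h

instance (a b : Piece) : Subsingleton (Hom a b) where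
  allEq f g := by
    cases f <;> cases g <;> first | rfl | omega

instance : SmallCategory Piece where
  Hom := Hom
  id := Hom.id
  comp := Hom.comp
  id_comp _ := Subsingleton.elim (α := Hom _ _) _ _
  comp_id _ := Subsingleton.elim (α := Hom _ _) _ _
  assoc _ _ _ := Subsingleton.elim (α := Hom _ _) _ _

instance : Quiver.IsThin Piece := fun a b => inferInstanceAs (Subsingleton (Hom a b))

end Piece

/-- The scheme attached to a piece. -/
def pieceObj : Piece → Scheme.{0}
  | .torus => Spec (.of LaurentRing)
  | .overlap _ => Spec (.of OverlapRing)
  | .chart _ => Spec (.of PlaneRing)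

/-- The open immersion attached to an inclusion of pieces. -/
def pieceMap : {a b : Piece} → Piece.Hom a b → (pieceObj a ⟶ pieceObj b)
  | _, _, .id _ => 𝟙 _
  | _, _, .torusOverlap n => Spec.map (CommRingCat.ofHom (overlapToTorus n))
  | _, _, .torusChart n => Spec.map (CommRingCat.ofHom (chartToTorus n))
  | _, _, .left _ _ _ => Spec.map (CommRingCat.ofHom leftToOverlap)
  | _, _, .right _ _ _ => Spec.map (CommRingCat.ofHom rightToOverlap)

/-- The diagram of schemes and open immersions whose colimit is `W`. -/
def gluingDiagram : Piece ⥤ Scheme.{0} where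
  obj := pieceObj
  map f := pieceMap f
  map_id _ := rfl
  map_comp {a b c} f g := by
    change Piece.Hom a b at f
    change Piece.Hom b c at g
    change pieceMap (Piece.Hom.comp f g) = pieceMap f ≫ pieceMap g
    cases f with
    | id => exact (Category.id_comp _).symm
    | torusOverlap n =>
      cases g with
      | id => exact (Category.comp_id _).symm
      | left _ m h =>
        subst h
        exact (specMap_overlapToTorus_left m).symm
      | right _ m h =>
        subst h
        exact (specMap_overlapToTorus_right n).symm
    | torusChart n => cases g with
      | id => exact (Category.comp_id _).symm
    | left n m h => cases g with
      | id => exact (Category.comp_id _).symm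
    | right n m h => cases g with
      | id => exact (Category.comp_id _).symm

instance {a b : Piece} (f : a ⟶ b) : IsOpenImmersion (gluingDiagram.map f) := by
  change IsOpenImmersion (pieceMap f)
  change Piece.Hom a b at f
  cases f with
  | id c => exact inferInstanceAs (IsOpenImmersion (𝟙 (pieceObj _)))
  | torusOverlap n => exact isOpenImmersion_overlapToTorus n
  | torusChart n => exact isOpenImmersion_torus n
  | left => exact isOpenImmersion_left
  | right => exact isOpenImmersion_right

theorem gluingDiagram_directed_aux {i j k : Piece} (e : i ⟶ j) (fi : i ⟶ k) (fj : j ⟶ k)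
    (xi : gluingDiagram.obj i) (xj : gluingDiagram.obj j)
    (h : gluingDiagram.map fi xi = gluingDiagram.map fj xj) : gluingDiagram.map e xi = xj := by
  apply (gluingDiagram.map fj).isOpenEmbedding.injective
  rw [← h, ← Scheme.Hom.comp_apply, ← gluingDiagram.map_comp, Subsingleton.elim (e ≫ fj) fi]

theorem exists_torus_point (m : ℤ)
    (x x' : Spec (.of OverlapRing))
    (hx : Spec.map (CommRingCat.ofHom leftToOverlap) x
      = Spec.map (CommRingCat.ofHom rightToOverlap) x') :
    ∃ z : Spec (.of LaurentRing), Spec.map (CommRingCat.ofHom (chartToTorus m)) z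
      = Spec.map (CommRingCat.ofHom leftToOverlap) x := by
  set p : PrimeSpectrum PlaneRing := Spec.map (CommRingCat.ofHom leftToOverlap) x with hp
  have hp1 : (X 0 : PlaneRing) ∉ p.asIdeal := fun hmem =>
    (PrimeSpectrum.isPrime x).ne_top (Ideal.eq_top_of_isUnit_mem _ (x := leftToOverlap (X 0))
      hmem (IsUnit.of_mul_eq_one _ overlapX_mul_inv))
  have hp2 : (X 1 : PlaneRing) ∉ p.asIdeal := by
    rw [hx]
    exact fun hmem =>
      (PrimeSpectrum.isPrime x').ne_top (Ideal.eq_top_of_isUnit_mem _ (x := rightToOverlap (X 1))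
        hmem (by rw [rightToOverlap_X1]; exact IsUnit.of_mul_eq_one_right _ overlapX_mul_inv))
  have hmem : p ∈ Set.range (PrimeSpectrum.comap (chartToTorus m)) := by
    rw [range_torus]
    exact fun hm => (p.isPrime.mem_or_mem hm).elim hp1 hp2
  exact hmem

instance : (gluingDiagram ⋙ Scheme.forget).IsLocallyDirected where
  cond {i j k} fi fj xi xj h := by
    change gluingDiagram.map fi xi = gluingDiagram.map fj xj at h
    by_cases e : Nonempty (i ⟶ j)
    · obtain ⟨e⟩ := e
      exact ⟨i, 𝟙 i, e, xi, by simp, gluingDiagram_directed_aux e fi fj xi xj h⟩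
    by_cases e' : Nonempty (j ⟶ i)
    · obtain ⟨e'⟩ := e'
      exact ⟨j, e', 𝟙 j, xj, gluingDiagram_directed_aux e' fj fi xj xi h.symm, by simp⟩
    have key : ∃ z : gluingDiagram.obj .torus, ∃ (t : Piece.torus ⟶ k) , 
        Nonempty (Piece.torus ⟶ i) ∧ Nonempty (Piece.torus ⟶ j) ∧
        gluingDiagram.map t z = gluingDiagram.map fi xi := by
      have h2 : pieceMap fi xi = pieceMap fj xj := h
      change ∃ (z : pieceObj .torus) (t : Piece.Hom Piece.torus k), 
        Nonempty (Piece.Hom Piece.torus i) ∧ Nonempty (Piece.Hom Piece.torus j) ∧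
        pieceMap t z = pieceMap fi xi
      clear h
      change ¬ Nonempty (Piece.Hom i j) at e
      change ¬ Nonempty (Piece.Hom j i) at e'
      change Piece.Hom i k at fi
      change Piece.Hom j k at fj
      cases fi with
      | id => exact absurd ⟨fj⟩ e'
      | torusOverlap => cases fj with
        | id => exact absurd ⟨.torusOverlap _⟩ e
        | torusOverlap => exact absurd ⟨.id _⟩ e
      | torusChart => cases fj with
        | id => exact absurd ⟨.torusChart _⟩ e
        | torusChart => exact absurd ⟨.id _⟩ e
        | left => exact absurd ⟨.torusOverlap _⟩ e
        | right => exact absurd ⟨.torusOverlap _⟩ e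
      | left n m hn => cases fj with
        | id => exact absurd ⟨.left _ _ hn⟩ e
        | torusChart => exact absurd ⟨.torusOverlap _⟩ e'
        | left n' _ hn' => exact absurd ⟨by rw [← hn, hn']; exact .id _⟩ e
        | right n' _ hn' =>
          obtain ⟨z, hz⟩ := exists_torus_point m xi xj h2
          exact ⟨z, .torusChart m, ⟨.torusOverlap _⟩, ⟨.torusOverlap _⟩, hz⟩
      | right n m hn => cases fj with
        | id => exact absurd ⟨.right _ _ hn⟩ e
        | torusChart => exact absurd ⟨.torusOverlap _⟩ e'
        | left n' _ hn' =>
          obtain ⟨z, hz⟩ := exists_torus_point m xj xi h2.symm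
          exact ⟨z, .torusChart m, ⟨.torusOverlap _⟩, ⟨.torusOverlap _⟩, hz.trans h2.symm⟩
        | right n' _ hn' =>
          exact absurd ⟨by rw [show n = n' by omega]; exact .id _⟩ e
    obtain ⟨z, t, ⟨a⟩, ⟨b⟩, hz⟩ := key
    exact ⟨.torus, a, b, z, gluingDiagram_directed_aux a t fi z xi hz,
      gluingDiagram_directed_aux b t fj z xj (hz.trans h)⟩

/-- The universal cover of the Tate curve: the affine planes `𝔸²ₙ`, `n ∈ ℤ`, glued along
`𝔸²ₙ ∖ {xₙ = 0} ≅ 𝔸²ₙ₊₁ ∖ {yₙ₊₁ = 0}`, `yₙ₊₁ = xₙ⁻¹`, `xₙ yₙ = xₙ₊₁ yₙ₊₁`. -/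
def W : Scheme.{0} := colimit gluingDiagram

/-- The chart `𝔸²ₙ → W`. -/
def chartι (n : ℤ) : Spec (.of PlaneRing) ⟶ W := colimit.ι gluingDiagram (.chart n)
/-- The inclusion of the overlap of the charts `n` and `n + 1`. -/
def overlapι (n : ℤ) : Spec (.of OverlapRing) ⟶ W := colimit.ι gluingDiagram (.overlap n)
/-- The inclusion of the torus `Spec ℤ[x^±1, π^±1] → W`, where `x = x₀`. -/
def torusι : Spec (.of LaurentRing) ⟶ W := colimit.ι gluingDiagram .torus

instance (n : ℤ) : IsOpenImmersion (chartι n) :=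
  inferInstanceAs (IsOpenImmersion (colimit.ι gluingDiagram (.chart n)))
instance : IsOpenImmersion torusι :=
  inferInstanceAs (IsOpenImmersion (colimit.ι gluingDiagram .torus))

theorem chartToTorus_comp_chartι (n : ℤ) :
    Spec.map (CommRingCat.ofHom (chartToTorus n)) ≫ chartι n = torusι :=
  colimit.w gluingDiagram (Piece.Hom.torusChart n : Piece.torus ⟶ Piece.chart n)

theorem left_comp_chartι (n : ℤ) :
    Spec.map (CommRingCat.ofHom leftToOverlap) ≫ chartι n = overlapι n :=
  colimit.w gluingDiagram (Piece.Hom.left n n rfl : Piece.overlap n ⟶ Piece.chart n)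

theorem right_comp_chartι (n : ℤ) :
    Spec.map (CommRingCat.ofHom rightToOverlap) ≫ chartι (n + 1) = overlapι n :=
  colimit.w gluingDiagram (Piece.Hom.right n _ rfl : Piece.overlap n ⟶ Piece.chart (n + 1))

/-- The map `T ↦ xₙ yₙ`. -/
def polyToPlane : Polynomial ℤ →+* PlaneRing :=
  (Polynomial.aeval (X 0 * X 1 : PlaneRing)).toRingHom
/-- The map `T ↦ xₙ yₙ` on an overlap. -/
def polyToOverlap : Polynomial ℤ →+* OverlapRing :=
  (Polynomial.aeval (overlapX * overlapY)).toRingHom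
/-- The map `T ↦ π`. -/
def polyToLaurent : Polynomial ℤ →+* LaurentRing :=
  (Polynomial.aeval (laurentMonomial 1 0)).toRingHom

/-- The affine line `Spec ℤ[T]`. -/
def affineLine : Scheme.{0} := Spec (.of (Polynomial ℤ))

/-- The function `xₙ yₙ` on every piece, as a map to the affine line. -/
def pieceπ : (c : Piece) → (pieceObj c ⟶ affineLine)
  | .torus => Spec.map (CommRingCat.ofHom polyToLaurent)
  | .overlap _ => Spec.map (CommRingCat.ofHom polyToOverlap)
  | .chart _ => Spec.map (CommRingCat.ofHom polyToPlane)

theorem specMap_comp_eq {R S T : Type} [CommRing R] [CommRing S] [CommRing T]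
    {f : R →+* S} {g : S →+* T} {h : R →+* T} (e : g.comp f = h) :
    Spec.map (CommRingCat.ofHom g) ≫ Spec.map (CommRingCat.ofHom f) =
      Spec.map (CommRingCat.ofHom h) := by
  rw [← Spec.map_comp, ← CommRingCat.ofHom_comp, e]

theorem overlapToTorus_comp_poly (n : ℤ) :
    (overlapToTorus n).comp polyToOverlap = polyToLaurent := by
  refine Polynomial.ringHom_ext (by simp) ?_
  simp [polyToOverlap, polyToLaurent, laurentMonomial_mul]

theorem chartToTorus_comp_poly (n : ℤ) : (chartToTorus n).comp polyToPlane = polyToLaurent := by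
  refine Polynomial.ringHom_ext (by simp) ?_
  simp [polyToPlane, polyToLaurent, laurentMonomial_mul]

theorem leftToOverlap_comp_poly : leftToOverlap.comp polyToPlane = polyToOverlap := by
  refine Polynomial.ringHom_ext (by simp) ?_
  simp [polyToOverlap, polyToPlane, overlapX, overlapY, leftToOverlap]

theorem rightToOverlap_comp_poly : rightToOverlap.comp polyToPlane = polyToOverlap := by
  refine Polynomial.ringHom_ext (by simp) ?_
  simp only [polyToOverlap, polyToPlane, AlgHom.toRingHom_eq_coe, RingHom.coe_comp,
    RingHom.coe_coe, Function.comp_apply, Polynomial.aeval_X, map_mul, rightToOverlap_X0,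
    rightToOverlap_X1]
  linear_combination overlapX * overlapY * overlapX_mul_inv

theorem pieceMap_comp_pieceπ {a b : Piece} (f : Piece.Hom a b) :
    pieceMap f ≫ pieceπ b = pieceπ a := by
  cases f with
  | id => exact Category.id_comp _
  | torusOverlap n => exact specMap_comp_eq (overlapToTorus_comp_poly n)
  | torusChart n => exact specMap_comp_eq (chartToTorus_comp_poly n)
  | left => exact specMap_comp_eq leftToOverlap_comp_poly
  | right => exact specMap_comp_eq rightToOverlap_comp_poly

/-- The map `π : W → 𝔸¹` given by `xₙ yₙ` on the chart `n`. -/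
def projπ : W ⟶ affineLine :=
  colimit.desc gluingDiagram
    { pt := affineLine
      ι :=
        { app := fun c => pieceπ c
          naturality := fun _ _ f =>
            (pieceMap_comp_pieceπ f).trans (Category.comp_id (pieceπ _)).symm } }

theorem chartι_comp_projπ (n : ℤ) :
    chartι n ≫ projπ = Spec.map (CommRingCat.ofHom polyToPlane) :=
  colimit.ι_desc _ (Piece.chart n)

/-- The fibre `W₀ = π⁻¹(0)`, as a closed set of points of `W`. -/
def centralFibre : Set W := projπ ⁻¹' (PrimeSpectrum.zeroLocus {(Polynomial.X : Polynomial ℤ)})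

/-- The locus `wₙ = {xₙ = yₙ = 0}`. -/
def node (n : ℤ) : Set W := chartι n '' (PrimeSpectrum.zeroLocus {(X 0 : PlaneRing), X 1})

/-- The rational curve `ℙ¹ₙ`: the closure of `{yₙ = 0}`, which contains `wₙ` and `wₙ₊₁` and is also the
closure of `{xₙ₊₁ = 0}`. -/
def component (n : ℤ) : Set W :=
  closure (chartι n '' (PrimeSpectrum.zeroLocus {(X 1 : PlaneRing)}))

/-- The curve `(𝔾ₘ)ₙ = ℙ¹ₙ ∖ (wₙ ∪ wₙ₊₁)`. -/
def openComponent (n : ℤ) : Set W := component n \ (node n ∪ node (n + 1))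

section Glue
variable (X : Scheme.{0})

/-- Restriction of functions. -/
def res {U V : X.Opens} (h : U ≤ V) : Γ(X, V) →+* Γ(X, U) := (X.presheaf.map (homOfLE h).op).hom

theorem res_res {U V V' : X.Opens} (h : U ≤ V) (h' : V ≤ V') (f : Γ(X, V')) :
    res X h (res X h' f) = res X (h.trans h') f := by
  simp only [res, ← CommRingCat.comp_apply, ← X.presheaf.map_comp]; rfl

theorem res_self {U : X.Opens} (h : U ≤ U) (f : Γ(X, U)) : res X h f = f := by
  have e : X.presheaf.map (homOfLE h).op = 𝟙 _ := X.presheaf.map_id (op U)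
  rw [res, e]; rfl

variable (U : ℤ → X.Opens) (g : ∀ n, Γ(X, U n))

/-- Families of functions, one on each `V ∩ Uₙ`. -/
abbrev Coord (V : X.Opens) : Type := ∀ n : ℤ, Γ(X, V ⊓ U n)

instance (V : X.Opens) : Module Γ(X, V) (Coord X U V) :=
  letI (n : ℤ) : Module Γ(X, V) Γ(X, V ⊓ U n) :=
    Module.compHom _ (res X (inf_le_left : V ⊓ U n ≤ V))
  Pi.module _ _ _

theorem coord_smul_apply {V : X.Opens} (r : Γ(X, V)) (f : Coord X U V) (n : ℤ) :
    (r • f) n = res X inf_le_left r * f n := rfl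

theorem triple_le_left (V : X.Opens) (n : ℤ) : V ⊓ (U n ⊓ U (n + 1)) ≤ V ⊓ U n :=
  inf_le_inf_left V inf_le_left
theorem triple_le_right (V : X.Opens) (n : ℤ) : V ⊓ (U n ⊓ U (n + 1)) ≤ V ⊓ U (n + 1) :=
  inf_le_inf_left V inf_le_right
theorem triple_le_chart (V : X.Opens) (n : ℤ) : V ⊓ (U n ⊓ U (n + 1)) ≤ U n :=
  inf_le_right.trans inf_le_left

/-- The sections over `V` of the sheaf glued from the trivial bundles on the `Uₙ` with transition
function `gₙ` on `Uₙ ∩ Uₙ₊₁`: families of functions `fₙ` on `V ∩ Uₙ` with `fₙ = gₙ fₙ₊₁` on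
`V ∩ Uₙ ∩ Uₙ₊₁`. -/
def gluedSections (V : X.Opens) : Submodule Γ(X, V) (Coord X U V) where
  carrier := {f | ∀ n : ℤ, res X (triple_le_left X U V n) (f n) =
    res X (triple_le_chart X U V n) (g n) * res X (triple_le_right X U V n) (f (n + 1))}
  zero_mem' n := by simp
  add_mem' {f f'} hf hf' n := by
    simp only [Pi.add_apply, map_add, hf n, hf' n, mul_add]
  smul_mem' r f hf n := by
    simp only [coord_smul_apply, map_mul, hf n, res_res]
    ring

/-- Restriction of glued sections. -/
def gluedRes {V V' : X.Opens} (h : V' ≤ V) : gluedSections X U g V →+ gluedSections X U g V' where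
  toFun f := ⟨fun n => res X (inf_le_inf_right (U n) h) (f.1 n), fun n => by
    have := congrArg (res X (inf_le_inf_right (U n ⊓ U (n + 1)) h)) (f.2 n)
    simpa only [map_mul, res_res] using this⟩
  map_zero' := by ext n; simp
  map_add' f f' := by ext n; simp

theorem gluedRes_id {V : X.Opens} (h : V ≤ V) (f : gluedSections X U g V) :
    gluedRes X U g h f = f :=
  Subtype.ext (funext fun _ => res_self X _ _)

theorem gluedRes_comp {V V' V'' : X.Opens} (h : V' ≤ V) (h' : V'' ≤ V')
    (f : gluedSections X U g V) :
    gluedRes X U g (h'.trans h) f = gluedRes X U g h' (gluedRes X U g h f) :=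
  Subtype.ext (funext fun _ => (res_res X _ _ _).symm)

theorem gluedRes_smul {V V' : X.Opens} (h : V' ≤ V) (r : Γ(X, V)) (f : gluedSections X U g V) :
    gluedRes X U g h (r • f) = res X h r • gluedRes X U g h f :=
  Subtype.ext (funext fun n => by
    change res X _ (res X _ r * f.1 n) = res X _ (res X _ r) * res X _ (f.1 n)
    rw [map_mul, res_res, res_res])

/-- The presheaf of abelian groups of glued sections. -/
def gluedAb : TopCat.Presheaf Ab.{0} X where
  obj V := .of (gluedSections X U g V.unop)
  map i := AddCommGrpCat.ofHom (gluedRes X U g i.unop.le)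
  map_id _ := AddCommGrpCat.hom_ext (AddMonoidHom.ext fun f => gluedRes_id X U g le_rfl f)
  map_comp i j :=
    AddCommGrpCat.hom_ext (AddMonoidHom.ext fun f => gluedRes_comp X U g i.unop.le j.unop.le f)

instance (V : (TopologicalSpace.Opens X)ᵒᵖ) :
    Module (X.ringCatSheaf.obj.obj V) ((gluedAb X U g).obj V) :=
  inferInstanceAs (Module Γ(X, V.unop) (gluedSections X U g V.unop))

theorem existsUnique_res {ι : Type} (V : ι → X.Opens) (V' : X.Opens) (hV : ∀ i, V i ≤ V')
    (hcover : V' ≤ iSup V) (sf : ∀ i, Γ(X, V i))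
    (h : ∀ i j, res X (inf_le_left : V i ⊓ V j ≤ V i) (sf i) = res X inf_le_right (sf j)) :
    ∃! s : Γ(X, V'), ∀ i, res X (hV i) s = sf i :=
  X.sheaf.existsUnique_gluing' V V' (fun i => homOfLE (hV i)) hcover sf h

theorem gluedAb_isSheaf : (gluedAb X U g).IsSheaf := by
  rw [TopCat.Presheaf.isSheaf_iff_isSheafUniqueGluing]
  intro ι V sf hsf
  let tf : ∀ i, gluedSections X U g (V i) := sf
  have htf : ∀ i j, gluedRes X U g (inf_le_left : V i ⊓ V j ≤ V i) (tf i) =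
      gluedRes X U g inf_le_right (tf j) := hsf
  have hle (n : ℤ) (i : ι) : V i ⊓ U n ≤ iSup V ⊓ U n := inf_le_inf_right _ (le_iSup V i)
  have key : ∀ n : ℤ, ∃! s : Γ(X, iSup V ⊓ U n), ∀ i, res X (hle n i) s = (tf i).1 n := by
    intro n
    refine existsUnique_res X (fun i => V i ⊓ U n) _ (hle n) (by rw [iSup_inf_eq])
      (fun i => (tf i).1 n) (fun i j => ?_)
    have hl : (V i ⊓ U n) ⊓ (V j ⊓ U n) ≤ (V i ⊓ V j) ⊓ U n :=
      le_inf (inf_le_inf inf_le_left inf_le_left) (inf_le_left.trans inf_le_right)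
    have h1 : res X _ ((tf i).1 n) = res X _ ((tf j).1 n) :=
      congrFun (congrArg Subtype.val (htf i j)) n
    have h2 := congrArg (res X hl) h1
    rwa [res_res, res_res] at h2
  choose s hs huniq using fun n => (key n)
  have hsmem : (s : Coord X U (iSup V)) ∈ gluedSections X U g (iSup V) := by
    intro n
    refine (existsUnique_res X (fun i => V i ⊓ (U n ⊓ U (n + 1))) (iSup V ⊓ (U n ⊓ U (n + 1)))
      (fun i => inf_le_inf_right _ (le_iSup V i)) (by rw [iSup_inf_eq])
      (fun i => res X (triple_le_left X U (V i) n) ((tf i).1 n))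
      (fun i j => ?_)).unique (fun i => ?_) (fun i => ?_)
    · rw [← hs n i, ← hs n j, res_res, res_res, res_res, res_res]
    · rw [← hs n i, res_res, res_res]
    · rw [(tf i).2 n, ← hs (n + 1) i, map_mul, res_res, res_res, res_res]
  refine ⟨(⟨s, hsmem⟩ : gluedSections X U g (iSup V)), fun i => ?_, fun t ht => ?_⟩
  · exact Subtype.ext (funext fun n => hs n i)
  · let t' : gluedSections X U g (iSup V) := t
    have ht' : ∀ i, gluedRes X U g (le_iSup V i) t' = tf i := ht
    refine Subtype.ext (funext fun n => huniq n (t'.1 n) (fun i => ?_))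
    exact congrFun (congrArg Subtype.val (ht' i)) n

/-- The presheaf of modules of glued sections. -/
def gluedPresheaf : X.PresheafOfModules :=
  PresheafOfModules.ofPresheaf (R := X.ringCatSheaf.obj) (gluedAb X U g)
    (fun _ _ i r f => gluedRes_smul X U g i.unop.le r f)

/-- The sheaf of modules of glued sections. -/
def gluedModule : X.Modules where
  val := gluedPresheaf X U g
  isSheaf := gluedAb_isSheaf X U g

/-- The coordinate `fₙ` of a section in the given trivialization over `Uₙ`. -/
def gluedCoord (V : X.Opens) (n : ℤ) : Γ(gluedModule X U g, V) →+ Γ(X, V ⊓ U n) where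
  toFun s := (show gluedSections X U g V from s).1 n
  map_zero' := rfl
  map_add' _ _ := rfl

end Glue

/-- The open subset `𝔸²ₙ` of `W`. -/
def chartOpen (n : ℤ) : W.Opens := chartι n ''ᵁ ⊤

/-- The function `xₙ` on the open subset `𝔸²ₙ` of `W`. -/
def coordX (n : ℤ) : Γ(W, chartOpen n) :=
  ((chartι n).appIso ⊤).inv ((Scheme.ΓSpecIso (.of PlaneRing)).inv (X 0 : PlaneRing))

/-- The line bundle `ℒ` on `W`, glued from trivial bundles on the charts with transition function
`xₙ` on `𝔸²ₙ ∩ 𝔸²ₙ₊₁`: a function `f` on the chart `n` is identified with `xₙ⁻¹ f` on the chart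
`n + 1`. -/
def lineBundle : W.Modules := gluedModule W chartOpen coordX

/-- The expression of a global section of `ℒ` in the given trivialization over `𝔸²ₙ`. -/
def coord (n : ℤ) : Γ(lineBundle, ⊤) →+ Γ(W, ⊤ ⊓ chartOpen n) :=
  gluedCoord W chartOpen coordX ⊤ n

/-- The nonvanishing locus of a global section of `ℒ`: the points of `W` at which the expression of
the section in the trivialization over a chart containing the point is nonzero in the residue
field. -/
def nonvanishingLocus (s : Γ(lineBundle, ⊤)) : Set W :=
  {w | ∃ n : ℤ, w ∈ W.basicOpen (coord n s)}

theorem torus_le_chart (n : ℤ) : (⊤ : (Spec (.of LaurentRing)).Opens) ≤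
    torusι ⁻¹ᵁ (⊤ ⊓ chartOpen n) := by
  intro t _
  refine ⟨trivial, Spec.map (CommRingCat.ofHom (chartToTorus n)) t, trivial, ?_⟩
  rw [← chartToTorus_comp_chartι n]
  rfl

/-- Restriction of global sections of `ℒ` to the torus, written as Laurent polynomials by means of the
given trivialization of `ℒ` over `𝔸²ₙ`. -/
def chartRestriction (n : ℤ) : Γ(lineBundle, ⊤) →+ LaurentRing :=
  ((Scheme.ΓSpecIso (.of LaurentRing)).hom.hom.comp
    (torusι.appLE (⊤ ⊓ chartOpen n) ⊤ (torus_le_chart n)).hom).toAddMonoidHom.comp (coord n)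

/-- Restriction of global sections of `ℒ` to the torus, written as Laurent polynomials by means of the
frame `π⁻¹ e₁` of `ℒ` over the torus, where `e₁` is the given frame over `𝔸²₁`. -/
def sectionEmbedding : Γ(lineBundle, ⊤) →+ LaurentRing :=
  (AddMonoidHom.mulLeft (laurentMonomial 1 0)).comp (chartRestriction 1)

end TateCover

end

open TateCover

namespace TateCover

/-! Write `T(n) = n(n-1)/2` (`triangle n`). A global section is a family of polynomials `fₙ ∈ ℤ[xₙ,
yₙ]`, and since everything embeds in the Laurent ring the gluing condition may be read on the torus:
`fₙ = πⁿ x · fₙ₊₁` (`mem_gluedSections_iff`). Because `T(n+1) = T(n) + n`, the product `π^T(n) xⁿ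
fₙ` does not depend on `n` (`laurentMonomial_mul_chartRestriction`), so any one `fₙ` determines the
section; this is injectivity.

For the image, put `c = k - (T(m+n) - T(n))`. If `π^k x^m` occurs in `fₙ`, then `π^c` occurs in the
coordinate on the chart `m + n`. A polynomial in `xⱼ, yⱼ` contains no negative pure power of `π = xⱼ
yⱼ`, so `c ≥ 0`. Conversely, if `c ≥ 0`, the monomials `xᵢ^(c + T(m+n-i+1)) yᵢ^(c + T(m+n-i))` are
compatible and glue to a section restricting to `π^k x^m`, because `T ≥ 0` (`exists_section_of_le`).

These exponents also give the nonvanishing locus. For `c > 0` both are positive on every chart,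
which leaves the torus. For `c = 0` they vanish only where `T` does, at `0` and `1`, and the locus
is exactly the chart `m + n`. Sorting the points of a chart by which coordinates vanish gives
`range_chartι`, hence the stated union.

The frame `π⁻¹ e₁` is the case `n = 1` with `k` shifted by one. -/

/-! ### Points of `W` and incidence of charts. -/

theorem exists_chartι_eq (w : W) : ∃ (n : ℤ) (p : PrimeSpectrum PlaneRing), chartι n p = w := by
  obtain ⟨c, x, rfl⟩ := Scheme.IsLocallyDirected.ι_jointly_surjective gluingDiagram w
  cases c with
  | torus =>
    refine ⟨0, Spec.map (CommRingCat.ofHom (chartToTorus 0)) x, ?_⟩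
    exact congrArg (fun f : Spec (.of LaurentRing) ⟶ W => f x) (chartToTorus_comp_chartι 0)
  | overlap n =>
    refine ⟨n, Spec.map (CommRingCat.ofHom leftToOverlap) x, ?_⟩
    exact congrArg (fun f : Spec (.of OverlapRing) ⟶ W => f x) (left_comp_chartι n)
  | chart n => exact ⟨n, x, rfl⟩

theorem isUnit_overlapX : IsUnit overlapX := .of_mul_eq_one _ overlapX_mul_inv

theorem isUnit_overlapXInv : IsUnit overlapXInv := .of_mul_eq_one_right _ overlapX_mul_inv

theorem notMem_of_isUnit {R : Type} [CommRing R] (z : PrimeSpectrum R) {r : R} (h : IsUnit r) :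
    r ∉ z.asIdeal := fun hr => z.isPrime.ne_top (Ideal.eq_top_of_isUnit_mem _ hr h)

theorem X_notMem_comap_chartToTorus (n : ℤ) (z : PrimeSpectrum LaurentRing) :
    X 0 ∉ (PrimeSpectrum.comap (chartToTorus n) z).asIdeal ∧
      X 1 ∉ (PrimeSpectrum.comap (chartToTorus n) z).asIdeal := by
  constructor
  · exact notMem_of_isUnit z ((chartToTorus_X0 n).symm ▸ isUnit_laurentMonomial _ _)
  · exact notMem_of_isUnit z ((chartToTorus_X1 n).symm ▸ isUnit_laurentMonomial _ _)

/-- On the overlap `xₙ` and `yₙ₊₁ = xₙ⁻¹` are units, and `xₙ₊₁ = xₙ² yₙ` differs from `yₙ` by a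
unit. -/
theorem mem_comap_overlap (z : PrimeSpectrum OverlapRing) :
    X 0 ∉ (PrimeSpectrum.comap leftToOverlap z).asIdeal ∧
      X 1 ∉ (PrimeSpectrum.comap rightToOverlap z).asIdeal ∧
      (X 1 ∈ (PrimeSpectrum.comap leftToOverlap z).asIdeal ↔
        X 0 ∈ (PrimeSpectrum.comap rightToOverlap z).asIdeal) := by
  refine ⟨notMem_of_isUnit z isUnit_overlapX,
    notMem_of_isUnit z (rightToOverlap_X1.symm ▸ isUnit_overlapXInv), ?_⟩
  rw [PrimeSpectrum.comap_asIdeal, PrimeSpectrum.comap_asIdeal, Ideal.mem_comap, Ideal.mem_comap,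
    rightToOverlap_X0]
  exact (Ideal.unit_mul_mem_iff_mem _ (isUnit_overlapX.pow 2)).symm

/-- Points of two charts with the same image in `W` are equal, or lie in the torus, or lie in the
overlap of two consecutive charts. -/
theorem chartι_eq_chartι {i j : ℤ} {p q : PrimeSpectrum PlaneRing} (h : chartι i p = chartι j q) :
    (i = j ∧ p = q) ∨
    ((X 0 ∉ p.asIdeal ∧ X 1 ∉ p.asIdeal) ∧ X 0 ∉ q.asIdeal ∧ X 1 ∉ q.asIdeal) ∨
    (j = i + 1 ∧ X 0 ∉ p.asIdeal ∧ X 1 ∉ q.asIdeal ∧ (X 1 ∈ p.asIdeal ↔ X 0 ∈ q.asIdeal)) ∨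
    (i = j + 1 ∧ X 0 ∉ q.asIdeal ∧ X 1 ∉ p.asIdeal ∧ (X 1 ∈ q.asIdeal ↔ X 0 ∈ p.asIdeal)) := by
  -- The diagram is locally directed, so two points with the same image come from one point of a
  -- piece mapping to both charts; the four outcomes are the possible pairs of inclusions.
  obtain ⟨k, fi, fj, z, hi, hj⟩ :=
    (Scheme.IsLocallyDirected.ι_eq_ι_iff gluingDiagram (i := .chart i) (j := .chart j)).1 h
  change pieceMap fi z = p at hi
  change pieceMap fj z = q at hj
  change Piece.Hom k (.chart i) at fi
  change Piece.Hom k (.chart j) at fj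
  cases fi with
  | id => cases fj with
    | id => exact .inl ⟨rfl, hi.symm.trans hj⟩
  | torusChart => cases fj with
    | torusChart =>
      subst hi hj
      exact .inr (.inl ⟨X_notMem_comap_chartToTorus i z, X_notMem_comap_chartToTorus j z⟩)
  | left n _ hn => cases fj with
    | left _ _ hm => exact .inl ⟨by omega, hi.symm.trans hj⟩
    | right _ _ hm =>
      subst hi hj
      exact .inr (.inr (.inl ⟨by omega, mem_comap_overlap z⟩))
  | right n _ hn => cases fj with
    | right _ _ hm => exact .inl ⟨by omega, hi.symm.trans hj⟩
    | left _ _ hm =>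
      subst hi hj
      exact .inr (.inr (.inr ⟨by omega, mem_comap_overlap z⟩))

theorem chartι_left_eq_chartι_right (n : ℤ) (z : PrimeSpectrum OverlapRing) :
    chartι n (PrimeSpectrum.comap leftToOverlap z) =
      chartι (n + 1) (PrimeSpectrum.comap rightToOverlap z) :=
  congrArg (fun f : Spec (.of OverlapRing) ⟶ W => f z)
    ((left_comp_chartι n).trans (right_comp_chartι n).symm)

theorem exists_comap_leftToOverlap {p : PrimeSpectrum PlaneRing} (h : X 0 ∉ p.asIdeal) :
    ∃ z, PrimeSpectrum.comap leftToOverlap z = p := by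
  have : p ∈ Set.range (PrimeSpectrum.comap leftToOverlap) :=
    (PrimeSpectrum.localization_away_comap_range OverlapRing (X 0 : PlaneRing)).symm ▸ h
  exact this

/-- By `rightToOverlap_eq` the right inclusion is the left one composed with two involutions, so the
description of the image transfers with `x` and `y` exchanged. -/
theorem exists_comap_rightToOverlap {p : PrimeSpectrum PlaneRing} (h : X 1 ∉ p.asIdeal) :
    ∃ z, PrimeSpectrum.comap rightToOverlap z = p := by
  obtain ⟨z, hz⟩ := exists_comap_leftToOverlap (p := PrimeSpectrum.comap planeSwap p)
    (by simpa [planeSwap] using h)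
  have hs : PrimeSpectrum.comap overlapSwap (PrimeSpectrum.comap overlapSwap z) = z := by
    rw [← PrimeSpectrum.comap_comp_apply, overlapSwap_comp]
    rfl
  refine ⟨PrimeSpectrum.comap overlapSwap z, ?_⟩
  rw [rightToOverlap_eq, PrimeSpectrum.comap_comp, PrimeSpectrum.comap_comp,
    Function.comp_apply, Function.comp_apply, hs, hz, ← PrimeSpectrum.comap_comp_apply,
    planeSwap_comp]
  rfl

theorem exists_chartι_add_one (n : ℤ) {p : PrimeSpectrum PlaneRing} (h : X 0 ∉ p.asIdeal) :
    ∃ q : PrimeSpectrum PlaneRing, chartι (n + 1) q = chartι n p ∧ X 1 ∉ q.asIdeal ∧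
      (X 1 ∈ p.asIdeal ↔ X 0 ∈ q.asIdeal) := by
  obtain ⟨z, rfl⟩ := exists_comap_leftToOverlap h
  exact ⟨_, (chartι_left_eq_chartι_right n z).symm, (mem_comap_overlap z).2⟩

theorem exists_chartι_of_add_one (n : ℤ) {q : PrimeSpectrum PlaneRing} (h : X 1 ∉ q.asIdeal) :
    ∃ p : PrimeSpectrum PlaneRing, chartι n p = chartι (n + 1) q ∧ X 0 ∉ p.asIdeal ∧
      (X 1 ∈ p.asIdeal ↔ X 0 ∈ q.asIdeal) := by
  obtain ⟨z, rfl⟩ := exists_comap_rightToOverlap h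
  exact ⟨_, chartι_left_eq_chartι_right n z, (mem_comap_overlap z).1, (mem_comap_overlap z).2.2⟩

theorem exists_torusι_eq (n : ℤ) {p : PrimeSpectrum PlaneRing} (h0 : X 0 ∉ p.asIdeal)
    (h1 : X 1 ∉ p.asIdeal) : chartι n p ∈ Set.range torusι := by
  have : p ∈ Set.range (PrimeSpectrum.comap (chartToTorus n)) := by
    rw [range_torus]
    exact fun hm => (p.isPrime.mem_or_mem hm).elim h0 h1
  obtain ⟨z, rfl⟩ := this
  refine ⟨z, ?_⟩
  rw [← chartToTorus_comp_chartι n]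
  rfl

/-! ### The central fibre, its nodes and its components, seen in the charts. -/

theorem chartι_mem_centralFibre {n : ℤ} {p : PrimeSpectrum PlaneRing} :
    chartι n p ∈ centralFibre ↔ X 0 ∈ p.asIdeal ∨ X 1 ∈ p.asIdeal := by
  rw [← p.isPrime.mul_mem_iff_mem_or_mem]
  have h : projπ (chartι n p) = PrimeSpectrum.comap polyToPlane p :=
    congrArg (fun f : Spec (.of PlaneRing) ⟶ affineLine => f p) (chartι_comp_projπ n)
  have hX : polyToPlane Polynomial.X = X 0 * X 1 := by simp [polyToPlane]
  change projπ (chartι n p) ∈ PrimeSpectrum.zeroLocus {(Polynomial.X : Polynomial ℤ)} ↔ _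
  rw [h, ← hX]
  exact Set.singleton_subset_iff

theorem range_torusι : Set.range torusι = centralFibreᶜ := by
  ext w
  constructor
  · rintro ⟨z, rfl⟩
    rw [← chartToTorus_comp_chartι 0]
    change chartι 0 (PrimeSpectrum.comap (chartToTorus 0) z) ∈ _
    rw [Set.mem_compl_iff, chartι_mem_centralFibre, not_or]
    exact X_notMem_comap_chartToTorus 0 z
  · obtain ⟨n, p, rfl⟩ := exists_chartι_eq w
    rw [Set.mem_compl_iff, chartι_mem_centralFibre, not_or]
    exact fun h => exists_torusι_eq n h.1 h.2

theorem chartι_mem_node {n : ℤ} {p : PrimeSpectrum PlaneRing} {m : ℤ} :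
    chartι n p ∈ node m ↔ n = m ∧ X 0 ∈ p.asIdeal ∧ X 1 ∈ p.asIdeal := by
  constructor
  · rintro ⟨q, hq, h⟩
    have hq' : X 0 ∈ q.asIdeal ∧ X 1 ∈ q.asIdeal :=
      ⟨hq (Set.mem_insert _ _), hq (Set.mem_insert_of_mem _ rfl)⟩
    have := chartι_eq_chartι (p := q) h
    rcases this with ⟨rfl, rfl⟩ | h | h | h
    · exact ⟨rfl, hq'⟩
    all_goals tauto
  · rintro ⟨rfl, h0, h1⟩
    refine ⟨p, ?_, rfl⟩
    rintro r (rfl | rfl)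
    exacts [h0, h1]

/-- The union of the two axes making up the curve `ℙ¹ₙ`. -/
def axes (n : ℤ) : Set W :=
  {w | (∃ p : PrimeSpectrum PlaneRing, X 1 ∈ p.asIdeal ∧ chartι n p = w) ∨
    ∃ p : PrimeSpectrum PlaneRing, X 0 ∈ p.asIdeal ∧ chartι (n + 1) p = w}

/-- The curve meets only the charts `n` and `n + 1`, each in one axis, so the complement is a union
of open images: all other charts, and these two with the axis removed. -/
theorem isClosed_axes (n : ℤ) : IsClosed (axes n) := by
  rw [← isOpen_compl_iff]
  have : (axes n)ᶜ = ⋃ j : ℤ, chartι j '' {p : PrimeSpectrum PlaneRing |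
      (j = n → X 1 ∉ p.asIdeal) ∧ (j = n + 1 → X 0 ∉ p.asIdeal)} := by
    ext w
    simp only [Set.mem_iUnion]
    constructor
    · obtain ⟨j, p, rfl⟩ := exists_chartι_eq w
      refine fun h => ⟨j, p, ⟨?_, ?_⟩, rfl⟩
      · rintro rfl hp
        exact h (.inl ⟨p, hp, rfl⟩)
      · rintro rfl hp
        exact h (.inr ⟨p, hp, rfl⟩)
    · rintro ⟨j, p, ⟨h1, h0⟩, rfl⟩ (⟨q, hq, e⟩ | ⟨q, hq, e⟩)
      · rcases chartι_eq_chartι e with ⟨rfl, rfl⟩ | h | h | h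
        · exact h1 rfl hq
        all_goals tauto
      · rcases chartι_eq_chartι e with ⟨rfl, rfl⟩ | h | h | ⟨h, h'⟩
        · exact h0 rfl hq
        · tauto
        · tauto
        · have : j = n := by omega
          tauto
  rw [this]
  refine isOpen_iUnion fun j => (chartι j).isOpenEmbedding.isOpenMap _ ?_
  change IsOpen {p : PrimeSpectrum PlaneRing | _}
  have hb (i : Fin 2) : IsOpen {p : PrimeSpectrum PlaneRing | X i ∉ p.asIdeal} :=
    (PrimeSpectrum.basicOpen (X i : PlaneRing)).isOpen
  by_cases h1 : j = n <;> by_cases h0 : j = n + 1 <;> simp only [h1, h0, forall_const] <;>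
    first | omega | skip
  · simpa using hb 1
  · simpa using hb 0
  · simp

theorem component_subset_axes (n : ℤ) : component n ⊆ axes n := by
  refine closure_minimal ?_ (isClosed_axes n)
  rintro _ ⟨p, hp, rfl⟩
  exact .inl ⟨p, hp rfl, rfl⟩

theorem chartι_mem_openComponent {n : ℤ} {p : PrimeSpectrum PlaneRing} (h0 : X 0 ∉ p.asIdeal)
    (h1 : X 1 ∈ p.asIdeal) : chartι n p ∈ openComponent n := by
  refine ⟨subset_closure ⟨p, ?_, rfl⟩, ?_⟩
  · rintro _ rfl
    exact h1
  · rw [Set.mem_union, chartι_mem_node, chartι_mem_node]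
    tauto

/-- Only the inclusion of the closure in `axes n` is needed: on the axis in the chart `n + 1`, every
point except the removed node `wₙ₊₁` already lies on the axis in the chart `n`. -/
theorem openComponent_eq (n : ℤ) : openComponent n =
    chartι n '' {p : PrimeSpectrum PlaneRing | X 0 ∉ p.asIdeal ∧ X 1 ∈ p.asIdeal} := by
  ext w
  constructor
  · rintro ⟨hw, hn⟩
    rw [Set.mem_union, not_or] at hn
    rcases component_subset_axes n hw with ⟨p, hp, rfl⟩ | ⟨p, hp, rfl⟩
    · rw [chartι_mem_node] at hn
      exact ⟨p, ⟨fun h => hn.1 ⟨rfl, h, hp⟩, hp⟩, rfl⟩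
    · rw [chartι_mem_node (m := n + 1)] at hn
      obtain ⟨q, hq, h⟩ := exists_chartι_of_add_one n (q := p) fun h => hn.2 ⟨rfl, hp, h⟩
      exact ⟨q, ⟨h.1, h.2.2 hp⟩, hq⟩
  · rintro ⟨p, ⟨h0, h1⟩, rfl⟩
    exact chartι_mem_openComponent h0 h1

/-- The four pieces correspond to which of `xₙ`, `yₙ` vanish. The locus `xₙ = 0`, `yₙ ≠ 0` becomes
`y = 0`, `x ≠ 0` in the previous chart, which is why `(𝔾ₘ)ₙ₋₁` appears. -/
theorem range_chartι (n : ℤ) : Set.range (chartι n) =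
    centralFibreᶜ ∪ openComponent (n - 1) ∪ openComponent n ∪ node n := by
  obtain ⟨n, rfl⟩ : ∃ m, n = m + 1 := ⟨n - 1, by ring⟩
  rw [add_sub_cancel_right]
  apply Set.Subset.antisymm
  · rintro _ ⟨p, rfl⟩
    change PrimeSpectrum PlaneRing at p
    by_cases h0 : X 0 ∈ p.asIdeal <;> by_cases h1 : X 1 ∈ p.asIdeal
    · exact .inr (chartι_mem_node.2 ⟨rfl, h0, h1⟩)
    · obtain ⟨q, hq, h⟩ := exists_chartι_of_add_one n h1
      rw [← hq]
      exact .inl (.inl (.inr (chartι_mem_openComponent h.1 (h.2.2 h0))))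
    · exact .inl (.inr (chartι_mem_openComponent h0 h1))
    · rw [← range_torusι]
      exact .inl (.inl (.inl (exists_torusι_eq _ h0 h1)))
  · rw [← range_torusι, openComponent_eq, openComponent_eq]
    rintro w (((⟨z, rfl⟩ | ⟨p, ⟨h0, -⟩, rfl⟩) | ⟨p, -, rfl⟩) | ⟨p, -, rfl⟩)
    · rw [← chartToTorus_comp_chartι (n + 1)]
      exact ⟨_, rfl⟩
    · obtain ⟨q, hq, -⟩ := exists_chartι_add_one n h0
      exact ⟨q, hq⟩
    · exact ⟨p, rfl⟩
    · exact ⟨p, rfl⟩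

/-! ### Functions on open subsets as elements of coordinate rings. -/

section EvalOn
variable {X : Scheme.{0}} {R S : Type} [CommRing R] [CommRing S] (f : Spec (.of R) ⟶ X)

/-- The pullback of a function along a map from an affine scheme, as an element of the ring. -/
noncomputable def evalOn {U : X.Opens} (e : ⊤ ≤ f ⁻¹ᵁ U) : Γ(X, U) →+* R :=
  (Scheme.ΓSpecIso (.of R)).hom.hom.comp (f.appLE U ⊤ e).hom

theorem evalOn_res {U V : X.Opens} (h : U ≤ V) (e : ⊤ ≤ f ⁻¹ᵁ U) (s : Γ(X, V)) :
    evalOn f e (res X h s) = evalOn f (e.trans fun _ hx => h hx) s :=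
  congrArg (fun g : Γ(X, V) ⟶ Γ(Spec (.of R), ⊤) => (Scheme.ΓSpecIso (.of R)).hom.hom (g.hom s))
    (f.map_appLE e (homOfLE h).op)

theorem evalOn_comp (φ : R →+* S) {f} {g : Spec (.of S) ⟶ X}
    (hg : Spec.map (CommRingCat.ofHom φ) ≫ f = g) {U : X.Opens} (e : ⊤ ≤ f ⁻¹ᵁ U)
    (e' : ⊤ ≤ g ⁻¹ᵁ U) (s : Γ(X, U)) : evalOn g e' s = φ (evalOn f e s) := by
  subst hg
  have h0 : (Spec.map (CommRingCat.ofHom φ)).appLE ⊤ ⊤ (fun _ _ => trivial) =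
    (Spec.map (CommRingCat.ofHom φ)).appTop := Scheme.Hom.appLE_eq_app _
  have h1 := Scheme.Hom.appLE_comp_appLE (Spec.map (CommRingCat.ofHom φ)) f U ⊤ ⊤ e
    (fun _ _ => trivial)
  have h2 := Scheme.ΓSpecIso_naturality (CommRingCat.ofHom φ)
  have h3 : f.appLE U ⊤ e ≫ (Spec.map (CommRingCat.ofHom φ)).appTop ≫
      (Scheme.ΓSpecIso (.of S)).hom = (Spec.map (CommRingCat.ofHom φ) ≫ f).appLE U ⊤ e' ≫
        (Scheme.ΓSpecIso (.of S)).hom := by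
    rw [← h1, Category.assoc, h0]
  rw [h2] at h3
  exact congrArg (fun g : Γ(X, U) ⟶ .of S => g.hom s) h3.symm

/-- Injectivity lets equations of functions on a chart or overlap be checked on ring elements;
surjectivity turns polynomials into functions on a chart. -/
theorem evalOn_bijective [IsOpenImmersion f] {U : X.Opens} (hU : U = f ''ᵁ ⊤)
    (e : ⊤ ≤ f ⁻¹ᵁ U) : Function.Bijective (evalOn f e) := by
  subst hU
  have h : f.appLE (f ''ᵁ ⊤) ⊤ e = (f.appIso ⊤).hom := (f.appIso_hom' ⊤).symm
  have : IsIso (f.appLE (f ''ᵁ ⊤) ⊤ e ≫ (Scheme.ΓSpecIso (.of R)).hom) := by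
    rw [h]
    infer_instance
  exact ConcreteCategory.bijective_of_isIso (f.appLE (f ''ᵁ ⊤) ⊤ e ≫ (Scheme.ΓSpecIso (.of R)).hom)

theorem mem_basicOpen_iff_evalOn {U : X.Opens} (e : ⊤ ≤ f ⁻¹ᵁ U) (s : Γ(X, U))
    (p : PrimeSpectrum R) : f p ∈ X.basicOpen s ↔ evalOn f e s ∉ p.asIdeal := by
  have h1 : p ∈ f ⁻¹ᵁ X.basicOpen s ↔ p ∈ (Spec (.of R)).basicOpen (f.appLE U ⊤ e s) := by
    rw [Scheme.basicOpen_appLE, top_inf_eq]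
  have h2 := basicOpen_eq_of_affine' (f.appLE U ⊤ e s)
  rw [h2] at h1
  exact h1

end EvalOn

/-! ### Global sections of `ℒ` as compatible families of polynomials. -/

theorem top_le_preimage_chartOpen (n : ℤ) :
    (⊤ : (Spec (.of PlaneRing)).Opens) ≤ chartι n ⁻¹ᵁ chartOpen n :=
  fun p hp => ⟨p, hp, rfl⟩

theorem top_le_preimage_top_inf_chartOpen (n : ℤ) :
    (⊤ : (Spec (.of PlaneRing)).Opens) ≤ chartι n ⁻¹ᵁ (⊤ ⊓ chartOpen n) :=
  fun p hp => ⟨trivial, p, hp, rfl⟩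

theorem evalOn_coordX (n : ℤ) :
    evalOn (chartι n) (top_le_preimage_chartOpen n) (coordX n) = X 0 := by
  have h : (chartι n).appLE (chartOpen n) ⊤ (top_le_preimage_chartOpen n) =
    ((chartι n).appIso ⊤).hom := ((chartι n).appIso_hom' ⊤).symm
  change (Scheme.ΓSpecIso (.of PlaneRing)).hom
    ((chartι n).appLE (chartOpen n) ⊤ (top_le_preimage_chartOpen n) (coordX n)) = _
  rw [h, coordX]
  exact (congrArg (Scheme.ΓSpecIso (.of PlaneRing)).hom
    (Iso.inv_hom_id_apply ((chartι n).appIso ⊤) _)).trans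
      (Iso.inv_hom_id_apply (Scheme.ΓSpecIso (.of PlaneRing)) _)

/-- The expression of a global section of `ℒ` in the given trivialization over `𝔸²ₙ`, as a
polynomial in `xₙ` and `yₙ`. -/
noncomputable def chartPoly (n : ℤ) : Γ(lineBundle, ⊤) →+ PlaneRing :=
  (evalOn (chartι n)
    (top_le_preimage_top_inf_chartOpen n)).toAddMonoidHom.comp (coord n)

theorem chartRestriction_eq (n : ℤ) (s : Γ(lineBundle, ⊤)) :
    chartRestriction n s = chartToTorus n (chartPoly n s) := by
  have h : chartRestriction n =
    (evalOn torusι (torus_le_chart n)).toAddMonoidHom.comp (coord n) := rfl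
  rw [h, chartPoly, AddMonoidHom.comp_apply, AddMonoidHom.comp_apply]
  exact evalOn_comp (chartToTorus n) (chartToTorus_comp_chartι n) _ (torus_le_chart n) (coord n s)

theorem lineBundle_ext {s t : Γ(lineBundle, ⊤)} (h : ∀ n, coord n s = coord n t) : s = t := by
  have key (s' t' : gluedSections W chartOpen coordX ⊤) (h' : ∀ n, s'.1 n = t'.1 n) : s' = t' :=
    Subtype.ext (funext h')
  exact key s t h

theorem lineBundle_ext_of_chartPoly {s t : Γ(lineBundle, ⊤)}
    (h : ∀ n, chartPoly n s = chartPoly n t) : s = t := by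
  refine lineBundle_ext fun n => ?_
  have hn := h n
  rw [chartPoly, AddMonoidHom.comp_apply, AddMonoidHom.comp_apply] at hn
  exact (evalOn_bijective (chartι n) (top_inf_eq (chartOpen n))
    (top_le_preimage_top_inf_chartOpen n)).1 hn

instance (n : ℤ) : IsOpenImmersion (overlapι n) :=
  inferInstanceAs (IsOpenImmersion (colimit.ι gluingDiagram (.overlap n)))

/-- Needed so that the gluing condition, an equation on this intersection, can be read in
`OverlapRing`. -/
theorem chartOpen_inf_chartOpen (n : ℤ) :
    chartOpen n ⊓ chartOpen (n + 1) = overlapι n ''ᵁ ⊤ := by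
  ext w
  constructor
  · rintro ⟨⟨p, -, rfl⟩, ⟨q, -, hq⟩⟩
    have h0 : X 0 ∉ (show PrimeSpectrum PlaneRing from p).asIdeal := by
      rcases chartι_eq_chartι hq with h | h | h | h
      · omega
      · exact h.2.1
      · omega
      · exact h.2.1
    obtain ⟨z, hz⟩ := exists_comap_leftToOverlap h0
    subst hz
    exact ⟨z, trivial, congrArg (fun f : Spec (.of OverlapRing) ⟶ W => f z)
      (left_comp_chartι n).symm⟩
  · rintro ⟨z, -, rfl⟩
    exact ⟨⟨_, trivial, congrArg (fun f : Spec (.of OverlapRing) ⟶ W => f z) (left_comp_chartι n)⟩,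
      ⟨_, trivial, congrArg (fun f : Spec (.of OverlapRing) ⟶ W => f z) (right_comp_chartι n)⟩⟩

theorem top_le_preimage_overlap (n : ℤ) : (⊤ : (Spec (.of OverlapRing)).Opens) ≤
    overlapι n ⁻¹ᵁ (⊤ ⊓ (chartOpen n ⊓ chartOpen (n + 1))) := by
  rw [chartOpen_inf_chartOpen, top_inf_eq]
  exact fun z hz => ⟨z, hz, rfl⟩

theorem overlapToTorus_injective (n : ℤ) : Function.Injective (overlapToTorus n) := by
  rw [injective_iff_map_eq_zero]
  intro a ha
  obtain ⟨N, b, hb⟩ := IsLocalization.Away.surj (X 0 : PlaneRing) a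
  have h1 : chartToTorus n b = 0 := by
    rw [← overlapToTorus_comp_left, RingHom.comp_apply]
    change overlapToTorus n (algebraMap PlaneRing OverlapRing b) = 0
    rw [← hb, map_mul, ha, zero_mul]
  rw [(map_eq_zero_iff _ (chartToTorus_injective n)).1 h1, map_zero] at hb
  exact (isUnit_overlapX.pow N).mul_left_eq_zero.1 hb

/-- The gluing condition of the line bundle, read on the torus. -/
theorem mem_gluedSections_iff (f : Coord W chartOpen ⊤) :
    f ∈ gluedSections W chartOpen coordX ⊤ ↔ ∀ n : ℤ,
      chartToTorus n (evalOn (chartι n) (top_le_preimage_top_inf_chartOpen n) (f n)) =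
        laurentMonomial n 1 * chartToTorus (n + 1) (evalOn (chartι (n + 1))
          (top_le_preimage_top_inf_chartOpen (n + 1)) (f (n + 1))) := by
  refine forall_congr' fun n => ?_
  have hl (a) : overlapToTorus n (leftToOverlap a) = chartToTorus n a :=
    RingHom.congr_fun (overlapToTorus_comp_left n) a
  have hr (a) : overlapToTorus n (rightToOverlap a) = chartToTorus (n + 1) a :=
    RingHom.congr_fun (overlapToTorus_comp_right n) a
  -- The condition is pulled back to `OverlapRing`, each term is factored through its chart, and the
  -- result is tested on the torus, into which the overlap ring embeds.
  rw [← (evalOn_bijective (overlapι n) (by rw [top_inf_eq, chartOpen_inf_chartOpen])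
    (top_le_preimage_overlap n)).1.eq_iff, map_mul, evalOn_res, evalOn_res, evalOn_res,
    evalOn_comp leftToOverlap (left_comp_chartι n)
      (top_le_preimage_top_inf_chartOpen n),
    evalOn_comp leftToOverlap (left_comp_chartι n) (top_le_preimage_chartOpen n),
    evalOn_comp rightToOverlap (right_comp_chartι n)
      (top_le_preimage_top_inf_chartOpen (n + 1)), evalOn_coordX,
    ← (overlapToTorus_injective n).eq_iff, map_mul, hl, hl, hr, chartToTorus_X0]

theorem chartRestriction_add_one (n : ℤ) (s : Γ(lineBundle, ⊤)) :
    chartRestriction n s = laurentMonomial n 1 * chartRestriction (n + 1) s := by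
  rw [chartRestriction_eq, chartRestriction_eq]
  exact (mem_gluedSections_iff (show gluedSections W chartOpen coordX ⊤ from s).1).1
    (show gluedSections W chartOpen coordX ⊤ from s).2 n

theorem exists_chartPoly_eq (P : ℤ → PlaneRing)
    (h : ∀ n, chartToTorus n (P n) = laurentMonomial n 1 * chartToTorus (n + 1) (P (n + 1))) :
    ∃ s : Γ(lineBundle, ⊤), ∀ n, chartPoly n s = P n := by
  choose f hf using fun n => (evalOn_bijective (chartι n) (top_inf_eq (chartOpen n))
      (top_le_preimage_top_inf_chartOpen n)).2 (P n)
  have hmem : f ∈ gluedSections W chartOpen coordX ⊤ := by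
    rw [mem_gluedSections_iff]
    intro n
    rw [hf, hf, h]
  exact ⟨(⟨f, hmem⟩ : gluedSections W chartOpen coordX ⊤), hf⟩

theorem nonvanishingLocus_eq (s : Γ(lineBundle, ⊤)) : nonvanishingLocus s =
    ⋃ n : ℤ, chartι n '' {p : PrimeSpectrum PlaneRing | chartPoly n s ∉ p.asIdeal} := by
  ext w
  rw [Set.mem_iUnion]
  refine exists_congr fun n => ?_
  have key (p : PrimeSpectrum PlaneRing) :
      chartι n p ∈ W.basicOpen (coord n s) ↔ chartPoly n s ∉ p.asIdeal :=
    mem_basicOpen_iff_evalOn _ _ _ p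
  constructor
  · intro hw
    obtain ⟨p, -, rfl⟩ := (W.basicOpen_le _ hw).2
    exact ⟨p, (key p).1 hw, rfl⟩
  · rintro ⟨p, hp, rfl⟩
    exact (key p).2 hp

/-! ### Triangular numbers and comparison of the frames on the torus. -/

/-- The triangular number `n (n - 1) / 2`. -/
def triangle (n : ℤ) : ℤ := n * (n - 1) / 2

theorem two_mul_triangle (n : ℤ) : 2 * triangle n = n * (n - 1) :=
  Int.mul_ediv_cancel' n.even_mul_pred_self.two_dvd

theorem triangle_add_one (n : ℤ) : triangle (n + 1) = triangle n + n := by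
  have h1 := two_mul_triangle n
  have h2 := two_mul_triangle (n + 1)
  have h3 : 2 * (triangle (n + 1)) = 2 * (triangle n + n) := by linear_combination h2 - h1
  omega

theorem triangle_nonneg (n : ℤ) : 0 ≤ triangle n := by
  have h := two_mul_triangle n
  have : 0 ≤ n * (n - 1) := by
    rcases le_or_gt n 0 with h | h
    · exact mul_nonneg_of_nonpos_of_nonpos h (by omega)
    · exact mul_nonneg h.le (by omega)
  omega

theorem triangle_eq_zero {n : ℤ} (h : triangle n = 0) : n = 0 ∨ n = 1 := by
  have h2 := two_mul_triangle n
  rw [h, mul_zero] at h2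
  rcases mul_eq_zero.1 h2.symm with h | h <;> omega

/-- The numerator is even, so the integer division is exact; the difference form is the one the
proof uses. -/
theorem exponent_bound_eq (n m : ℤ) :
    (m ^ 2 + (2 * n - 1) * m) / 2 = triangle (m + n) - triangle n := by
  have h1 := two_mul_triangle n
  have h2 := two_mul_triangle (m + n)
  have h3 : m ^ 2 + (2 * n - 1) * m = 2 * (triangle (m + n) - triangle n) := by
    linear_combination h1 - h2
  omega

/-- Gluing gives `eₙ₊₁ = xₙ eₙ` with `xₙ = πⁿ x`, so all the frames `π^(-T(n)) x^(-n) eₙ` equal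
`e₀`; both sides are the coordinate of `s` in it. -/
theorem laurentMonomial_mul_chartRestriction (s : Γ(lineBundle, ⊤)) (i j : ℤ) :
    laurentMonomial (triangle i) i * chartRestriction i s =
      laurentMonomial (triangle j) j * chartRestriction j s := by
  have step (n : ℤ) : laurentMonomial (triangle n) n * chartRestriction n s =
      laurentMonomial (triangle (n + 1)) (n + 1) * chartRestriction (n + 1) s := by
    rw [chartRestriction_add_one n, ← mul_assoc, laurentMonomial_mul, triangle_add_one]
  have key (n : ℤ) : laurentMonomial (triangle n) n * chartRestriction n s =
      laurentMonomial (triangle 0) 0 * chartRestriction 0 s := by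
    induction n with
    | zero => rfl
    | succ n ih => rw [← step, ih]
    | pred n ih => rw [step, sub_add_cancel, ih]
  rw [key i, key j]

theorem chartRestriction_injective (n : ℤ) : Function.Injective (chartRestriction n) := by
  rw [injective_iff_map_eq_zero]
  intro s hs
  refine lineBundle_ext_of_chartPoly fun i => ?_
  have h := laurentMonomial_mul_chartRestriction s i n
  rw [hs, mul_zero, (isUnit_laurentMonomial _ _).mul_right_eq_zero, chartRestriction_eq,
    map_eq_zero_iff _ (chartToTorus_injective i)] at h
  rw [h, map_zero]

/-! ### The image of restriction to the torus. -/

/-- The monomial `xₙ^a yₙ^b` goes to `π^(nm + b) x^m` with `m = a - b`, and `b ≥ 0`. The further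
constraint from `a ≥ 0` is not needed. -/
theorem le_of_coeff_chartToTorus_ne_zero {n : ℤ} {P : PlaneRing} {k m : ℤ}
    (h : (chartToTorus n P).coeff (k, m) ≠ 0) : n * m ≤ k := by
  induction P using MvPolynomial.induction_on' with
  | monomial a r =>
    rw [chartToTorus_monomial, AddMonoidAlgebra.coeff_single] at h
    have h' := Finsupp.single_apply_ne_zero.1 h
    obtain ⟨h1, h2⟩ := Prod.mk.inj h'.1
    have h3 : k = n * m + a 1 := by rw [h1, h2]; ring
    omega
  | add p q hp hq =>
    rw [map_add, AddMonoidAlgebra.coeff_add, Finsupp.add_apply] at h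
    by_cases h0 : (chartToTorus n p).coeff (k, m) = 0
    · exact hq (by rwa [h0, zero_add] at h)
    · exact hp h0

theorem bound_of_coeff_chartRestriction_ne_zero {n : ℤ} {s : Γ(lineBundle, ⊤)} {k m : ℤ}
    (h : (chartRestriction n s).coeff (k, m) ≠ 0) : triangle (m + n) - triangle n ≤ k := by
  have h1 := laurentMonomial_mul_chartRestriction s n (m + n)
  have h2 := congrArg (fun f : LaurentRing => f.coeff (triangle n + k, n + m)) h1
  -- The chart `m + n` is the one in which the monomial loses its power of `x`, so the bound there
  -- is nonnegativity of the exponent of `π`.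
  have h3 : (chartRestriction (m + n) s).coeff (triangle n + k - triangle (m + n), 0) ≠ 0 := by
    simp only [laurentMonomial, AddMonoidAlgebra.coeff_single_mul_apply, one_mul] at h2
    convert h using 1
    convert h2.symm using 2 <;> ext <;> simp <;> ring
  rw [chartRestriction_eq] at h3
  have h4 := le_of_coeff_chartToTorus_ne_zero h3
  omega

theorem chartToTorus_pow_mul_pow (n : ℤ) (a b : ℕ) :
    chartToTorus n (X 0 ^ a * X 1 ^ b) = laurentMonomial (n * (a - b) + b) (a - b) := by
  have h : (X 0 ^ a * X 1 ^ b : PlaneRing) =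
      monomial (Finsupp.single 0 a + Finsupp.single 1 b) 1 := by
    rw [X_pow_eq_monomial, X_pow_eq_monomial, monomial_mul, one_mul]
  rw [h, chartToTorus_monomial, laurentMonomial]
  congr 1
  ext <;> simp
  ring

/-- The excess `c` contributes `(xᵢ yᵢ)^c = π^c`; the rest is a monomial whose exponents differ by
`T(j+1) - T(j) = j`, with `j = m + n - i` the power of `x` prescribed by the frame `eᵢ`.
Nonnegativity of `T` makes `toNat` harmless. -/
theorem exists_section_of_le {n k m : ℤ} (h : triangle (m + n) - triangle n ≤ k) :
    ∃ s : Γ(lineBundle, ⊤), chartRestriction n s = laurentMonomial k m ∧ ∀ i, chartPoly i s =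
      X 0 ^ (k - (triangle (m + n) - triangle n) + triangle (m + n - i + 1)).toNat *
        X 1 ^ (k - (triangle (m + n) - triangle n) + triangle (m + n - i)).toNat := by
  set c := k - (triangle (m + n) - triangle n) with hc
  have hval (i : ℤ) : chartToTorus i (X 0 ^ (c + triangle (m + n - i + 1)).toNat *
      X 1 ^ (c + triangle (m + n - i)).toNat) =
        laurentMonomial (i * (m + n - i) + c + triangle (m + n - i)) (m + n - i) := by
    have h1 := triangle_nonneg (m + n - i + 1)
    have h2 := triangle_nonneg (m + n - i)
    rw [chartToTorus_pow_mul_pow, Int.toNat_of_nonneg (by omega), Int.toNat_of_nonneg (by omega),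
      triangle_add_one]
    congr 1 <;> ring
  obtain ⟨s, hs⟩ := exists_chartPoly_eq (fun i => X 0 ^ (c + triangle (m + n - i + 1)).toNat *
      X 1 ^ (c + triangle (m + n - i)).toNat) fun i => by
    have h3 := triangle_add_one (m + n - (i + 1))
    rw [show m + n - (i + 1) + 1 = m + n - i by ring] at h3
    rw [hval, hval, laurentMonomial_mul, h3]
    congr 1 <;> ring
  refine ⟨s, ?_, hs⟩
  rw [chartRestriction_eq, hs, hval]
  have h1 := two_mul_triangle n
  have h2 := two_mul_triangle (m + n)
  have h3 := two_mul_triangle (m + n - n)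
  have h4 : 2 * (n * (m + n - n) + c + triangle (m + n - n)) = 2 * k := by
    linear_combination h1 - h2 + h3 + 2 * hc
  rw [show n * (m + n - n) + c + triangle (m + n - n) = k by omega, add_sub_cancel_right]

theorem mem_span_laurentMonomial {S : ℤ → ℤ → Prop} {f : LaurentRing}
    (h : ∀ k m, f.coeff (k, m) ≠ 0 → S k m) :
    f ∈ Submodule.span ℤ {f : LaurentRing | ∃ k m : ℤ, S k m ∧ f = laurentMonomial k m} := by
  have hf : f = ∑ x ∈ f.coeff.support, f.coeff x • laurentMonomial x.1 x.2 := by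
    conv_lhs => rw [← AddMonoidAlgebra.sum_coeff_single f]
    simp [laurentMonomial, Finsupp.sum]
  rw [hf]
  exact Submodule.sum_mem _ fun x hx => Submodule.smul_mem _ _
    (Submodule.subset_span ⟨x.1, x.2, h _ _ (Finsupp.mem_support_iff.1 hx), rfl⟩)

theorem range_chartRestriction (n : ℤ) : Set.range (chartRestriction n) =
    (Submodule.span ℤ {f : LaurentRing | ∃ k m : ℤ,
      triangle (m + n) - triangle n ≤ k ∧ f = laurentMonomial k m} : Set LaurentRing) := by
  apply Set.Subset.antisymm
  · rintro _ ⟨s, rfl⟩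
    exact mem_span_laurentMonomial (S := fun k m => triangle (m + n) - triangle n ≤ k)
      fun k m h => bound_of_coeff_chartRestriction_ne_zero h
  · have : Submodule.span ℤ {f : LaurentRing | ∃ k m : ℤ,
        triangle (m + n) - triangle n ≤ k ∧ f = laurentMonomial k m} ≤
          (chartRestriction n).range.toIntSubmodule := by
      rw [Submodule.span_le]
      rintro _ ⟨k, m, h, rfl⟩
      obtain ⟨s, hs, -⟩ := exists_section_of_le h
      exact ⟨s, hs⟩
    exact this

/-! ### Nonvanishing loci of monomial sections. -/

theorem pow_mul_pow_notMem {p : PrimeSpectrum PlaneRing} {a b : ℕ} :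
    (X 0 ^ a * X 1 ^ b : PlaneRing) ∉ p.asIdeal ↔
      (a ≠ 0 → X 0 ∉ p.asIdeal) ∧ (b ≠ 0 → X 1 ∉ p.asIdeal) := by
  have hpow (x : PlaneRing) (a : ℕ) : x ^ a ∉ p.asIdeal ↔ (a ≠ 0 → x ∉ p.asIdeal) := by
    rcases eq_or_ne a 0 with rfl | ha
    · simpa using (Ideal.ne_top_iff_one _).1 p.isPrime.ne_top
    · rw [p.isPrime.pow_mem_iff_mem a (Nat.pos_of_ne_zero ha)]
      tauto
  rw [p.isPrime.mul_mem_iff_mem_or_mem, not_or, hpow, hpow]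

theorem range_torusι_subset_range_chartι (n : ℤ) : Set.range torusι ⊆ Set.range (chartι n) := by
  rw [range_torusι, range_chartι]
  exact fun w hw => .inl (.inl (.inl hw))

theorem nonvanishingLocus_eq_of_chartRestriction_eq {n k m : ℤ} {s : Γ(lineBundle, ⊤)}
    (hs : chartRestriction n s = laurentMonomial k m) :
    (k = triangle (m + n) - triangle n → nonvanishingLocus s = Set.range (chartι (m + n))) ∧
    (triangle (m + n) - triangle n < k → nonvanishingLocus s = centralFibreᶜ) := by
  have hP (h : triangle (m + n) - triangle n ≤ k) (i : ℤ) (p : PrimeSpectrum PlaneRing) :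
      chartPoly i s ∉ p.asIdeal ↔
      (0 < k - (triangle (m + n) - triangle n) + triangle (m + n - i + 1) → X 0 ∉ p.asIdeal) ∧
        (0 < k - (triangle (m + n) - triangle n) + triangle (m + n - i) → X 1 ∉ p.asIdeal) := by
    obtain ⟨t, ht, htP⟩ := exists_section_of_le h
    -- By injectivity `s` is the explicit section, so its coordinate on every chart is known.
    obtain rfl := chartRestriction_injective n (hs.trans ht.symm)
    rw [htP, pow_mul_pow_notMem, ← Nat.pos_iff_ne_zero, ← Nat.pos_iff_ne_zero,
      Int.lt_toNat, Int.lt_toNat, Nat.cast_zero]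
  rw [nonvanishingLocus_eq]
  refine ⟨fun h => ?_, fun h => ?_⟩
  · have hP' := hP h.ge
    simp only [← h, sub_self, zero_add] at hP'
    apply Set.Subset.antisymm
    · refine Set.iUnion_subset fun i => ?_
      rintro _ ⟨p, hp, rfl⟩
      obtain ⟨h0, h1⟩ := (hP' i p).1 hp
      have t0 := triangle_nonneg (m + n - i + 1)
      have t1 := triangle_nonneg (m + n - i)
      -- The `yᵢ`-exponent vanishes for `i = m + n` and `i = m + n - 1`. In the second case the
      -- `xᵢ`-exponent is `T(2) = 1`, so `xᵢ ≠ 0` and the point lies in the next chart.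
      rcases t1.eq_or_lt with e1 | e1
      · rcases triangle_eq_zero e1.symm with e | e
        · rw [show m + n = i by omega]
          exact ⟨p, rfl⟩
        · obtain ⟨q, hq, -⟩ := exists_chartι_add_one i (p := p) (h0 (by rw [e]; decide))
          rw [show m + n = i + 1 by omega]
          exact ⟨q, hq⟩
      -- Symmetrically, for `i = m + n + 1` the condition `yᵢ ≠ 0` moves the point back to the chart
      -- `m + n`; if both exponents are positive the point is in the torus.
      · rcases t0.eq_or_lt with e0 | e0
        · rcases triangle_eq_zero e0.symm with e | e
          · obtain rfl : i = m + n + 1 := by omega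
            obtain ⟨q, hq, -⟩ := exists_chartι_of_add_one (m + n) (q := p) (h1 e1)
            exact ⟨q, hq⟩
          · rw [show m + n = i by omega]
            exact ⟨p, rfl⟩
        · exact range_torusι_subset_range_chartι _ (exists_torusι_eq i (h0 e0) (h1 e1))
    · rintro _ ⟨p, rfl⟩
      -- On the chart `m + n` the exponents are `T(1) = T(0) = 0`, so the section is a frame there.
      refine Set.mem_iUnion.2 ⟨m + n, p, (hP' _ p).2 ?_, rfl⟩
      rw [sub_self]
      exact ⟨fun h => absurd h (by decide), fun h => absurd h (by decide)⟩
  · rw [← range_torusι]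
    apply Set.Subset.antisymm
    · refine Set.iUnion_subset fun i => ?_
      rintro _ ⟨p, hp, rfl⟩
      have t0 := triangle_nonneg (m + n - i + 1)
      have t1 := triangle_nonneg (m + n - i)
      obtain ⟨h0, h1⟩ := (hP h.le i p).1 hp
      exact exists_torusι_eq i (h0 (by omega)) (h1 (by omega))
    · rintro _ ⟨z, rfl⟩
      rw [← chartToTorus_comp_chartι n]
      have hz := X_notMem_comap_chartToTorus n z
      exact Set.mem_iUnion.2 ⟨n, PrimeSpectrum.comap (chartToTorus n) z,
        (hP h.le n _).2 ⟨fun _ => hz.1, fun _ => hz.2⟩, rfl⟩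

/-! ### The frame `π⁻¹ e₁` and the final statement. -/

theorem sectionEmbedding_apply (s : Γ(lineBundle, ⊤)) :
    sectionEmbedding s = laurentMonomial 1 0 * chartRestriction 1 s := rfl

theorem sectionEmbedding_injective : Function.Injective sectionEmbedding := fun _ _ h =>
  chartRestriction_injective 1 ((isUnit_laurentMonomial 1 0).mul_left_cancel h)

/-- A coordinate in the frame `π⁻¹ e₁` is `π` times the one in `e₁`; this is the source of the `+ 1`
in the first bound. -/
theorem sectionEmbedding_eq_iff (s : Γ(lineBundle, ⊤)) (k m : ℤ) :
    sectionEmbedding s = laurentMonomial k m ↔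
      chartRestriction 1 s = laurentMonomial (k - 1) m := by
  have h : laurentMonomial k m = laurentMonomial 1 0 * laurentMonomial (k - 1) m := by
    rw [laurentMonomial_mul, zero_add, add_sub_cancel]
  rw [sectionEmbedding_apply, h, (isUnit_laurentMonomial 1 0).mul_right_inj]

theorem exponent_bound_eq_one (m : ℤ) :
    (m ^ 2 + m) / 2 = triangle (m + 1) - triangle 1 := by
  rw [← exponent_bound_eq]
  norm_num

theorem range_sectionEmbedding : Set.range sectionEmbedding =
    (Submodule.span ℤ {f : LaurentRing | ∃ k m : ℤ,
      triangle (m + 1) - triangle 1 + 1 ≤ k ∧ f = laurentMonomial k m} : Set LaurentRing) := by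
  apply Set.Subset.antisymm
  · rintro _ ⟨s, rfl⟩
    refine mem_span_laurentMonomial (S := fun k m => triangle (m + 1) - triangle 1 + 1 ≤ k)
      fun k m h => ?_
    rw [sectionEmbedding_apply, laurentMonomial, AddMonoidAlgebra.coeff_single_mul_apply,
      one_mul] at h
    have h' : (chartRestriction 1 s).coeff (k - 1, m) ≠ 0 := by
      convert h using 3
      · simp
        ring
      · simp
    have := bound_of_coeff_chartRestriction_ne_zero h'
    omega
  · have : Submodule.span ℤ {f : LaurentRing | ∃ k m : ℤ,
        triangle (m + 1) - triangle 1 + 1 ≤ k ∧ f = laurentMonomial k m} ≤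
          sectionEmbedding.range.toIntSubmodule := by
      rw [Submodule.span_le]
      rintro _ ⟨k, m, h, rfl⟩
      obtain ⟨s, hs, -⟩ := exists_section_of_le (n := 1) (k := k - 1) (m := m) (by omega)
      exact ⟨s, (sectionEmbedding_eq_iff s k m).2 hs⟩
    exact this

end TateCover

theorem mainTheorem12 :
    Set.range torusι = centralFibreᶜ ∧
    (Function.Injective sectionEmbedding ∧
      Set.range sectionEmbedding =
        (Submodule.span ℤ {f : LaurentRing |
          ∃ k m : ℤ, (m ^ 2 + m) / 2 + 1 ≤ k ∧ f = laurentMonomial k m} : Set LaurentRing) ∧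
      ∀ (s : Γ(lineBundle, ⊤)) (k m : ℤ), sectionEmbedding s = laurentMonomial k m →
        (k = (m ^ 2 + m) / 2 + 1 → nonvanishingLocus s =
          centralFibreᶜ ∪ openComponent m ∪ openComponent (m + 1) ∪ node (m + 1)) ∧
        ((m ^ 2 + m) / 2 + 1 < k → nonvanishingLocus s = centralFibreᶜ)) ∧
    ∀ n : ℤ,
      Function.Injective (chartRestriction n) ∧
      Set.range (chartRestriction n) =
        (Submodule.span ℤ {f : LaurentRing |
          ∃ k m : ℤ, (m ^ 2 + (2 * n - 1) * m) / 2 ≤ k ∧ f = laurentMonomial k m} :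
            Set LaurentRing) ∧
      ∀ (s : Γ(lineBundle, ⊤)) (k m : ℤ), chartRestriction n s = laurentMonomial k m →
        (k = (m ^ 2 + (2 * n - 1) * m) / 2 → nonvanishingLocus s =
          centralFibreᶜ ∪ openComponent (m + n - 1) ∪ openComponent (m + n) ∪ node (m + n)) ∧
        ((m ^ 2 + (2 * n - 1) * m) / 2 < k → nonvanishingLocus s = centralFibreᶜ) := by
  refine ⟨range_torusι, ⟨sectionEmbedding_injective, ?_, fun s k m h => ?_⟩, fun n =>
    ⟨chartRestriction_injective n, ?_, fun s k m h => ?_⟩⟩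
  · simp only [exponent_bound_eq_one]
    exact range_sectionEmbedding
  · have key := nonvanishingLocus_eq_of_chartRestriction_eq ((sectionEmbedding_eq_iff s k m).1 h)
    rw [range_chartι, add_sub_cancel_right] at key
    rw [exponent_bound_eq_one]
    exact ⟨fun h => key.1 (by omega), fun h => key.2 (by omega)⟩
  · simp only [exponent_bound_eq]
    exact range_chartRestriction n
  · have key := nonvanishingLocus_eq_of_chartRestriction_eq h
    rw [range_chartι] at key
    rwa [exponent_bound_eq]
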